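/- There are absolute constants $c,C>0$ such that the following holds for all integers $n\ge 1$ and $p\ge 0$ with $p\le 2^{n/200}$, every set $\mathcal Z$ and every function $f:\{0,1\}^p\to\mathcal Z$. Let $g$ be either the inner-product function $\mathrm{IP}_n:\{0,1\}^n\times\{0,1\}^n\to\{0,1\}$, $\mathrm{IP}_n(x,y)=\sum_{i=1}^n x_iy_i \bmod 2$, or, for some real $\gamma$ with $0\le\gamma\le \frac14$, the gap-Hamming promise problem $\mathrm{GH}_{n,\gamma}$, that is, the partial function on $\{0,1\}^n\times\{0,1\}^n$ that is $1$ on the pairs at Hamming distance at least $(\frac12+\gamma)n$, is $0$ on the pairs at Hamming distance at most $(\frac12-\gamma)n$, and is undefined on all other pairs (for $\gamma=0$ a pair at distance exactly $n/2$ may be given either value). Let $f\circ g^p$ be the (partial) function $(x,y)\mapsto f(g(x_1,y_1),\dots,g(x_p,y_p))$, where Alice holds $x\in(\{0,1\}^n)^p$ and Bob holds $y\in(\{0,1\}^n)^p$, defined when all $g(x_i,y_i)$ are defined. Then $$c\cdot \mathcal D^{dt}(f)\cdot n\;\le\;\mathcal D^{cc}(f\circ g^p)\;\le\; C\cdot \mathcal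 D^{dt}(f)\cdot n ,$$ i.e. $\mathcal D^{cc}(f\circ g^p)=\Theta(\mathcal D^{dt}(f)\cdot n)$. Here $\mathcal D^{dt}(f)$ is the deterministic query complexity of $f$ (the least height of a decision tree, querying one input bit per internal node, that computes $f$ on every input), and $\mathcal D^{cc}(F)$ is the deterministic communication complexity of $F$ (the least height of a two-party protocol tree, one communicated bit per internal node, whose output is correct on every input on which $F$ is defined). -/

import Mathlib

/-- Deterministic two-party protocols on inputs in `A × B` with outputs in `Z`. An internal node
belongs to Alice or to Bob and carries the function that computes the bit which the owner sends;
the first subtree is entered on the bit 0 (`false`), the second one on the bit 1 (`true`). -/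
inductive Protocol (A B : Type) (Z : Type*) where
  | leaf (z : Z) : Protocol A B Z
  | alice (m : A → Bool) (child0 child1 : Protocol A B Z) : Protocol A B Z
  | bob (m : B → Bool) (child0 child1 : Protocol A B Z) : Protocol A B Z

namespace Protocol

/-- The output of the execution of a protocol on the input `(a, b)`. -/
def eval {A B : Type} {Z : Type*} : Protocol A B Z → A → B → Z
  | leaf z, _, _ => z
  | alice m c0 c1, a, b => if m a then c1.eval a b else c0.eval a b
  | bob m c0 c1, a, b => if m b then c1.eval a b else c0.eval a b

/-- The communication complexity of a protocol: the height of its tree. -/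
def height {A B : Type} {Z : Type*} : Protocol A B Z → ℕ
  | leaf _ => 0
  | alice _ c0 c1 => max c0.height c1.height + 1
  | bob _ c0 c1 => max c0.height c1.height + 1

/-- The protocol computes the (possibly partial) function `F` (`none` means undefined): it is
correct on every input in the domain of `F`. -/
def Computes {A B : Type} {Z : Type*} (π : Protocol A B Z) (F : A → B → Option Z) : Prop :=
  ∀ a b z, F a b = some z → π.eval a b = z

/-- On finite input sets every partial function has a protocol, so that the infimum in the
definition of the communication complexity is taken over a non-empty set. -/
theorem exists_computes {A B : Type} {Z : Type*} [Finite A] [Finite B] [Nonempty Z]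
    (F : A → B → Option Z) : ∃ π : Protocol A B Z, π.Computes F := by
  classical
  obtain ⟨z0⟩ := ‹Nonempty Z›
  cases nonempty_fintype A
  cases nonempty_fintype B
  have hB : ∀ (a : A) (l : List B), ∃ π : Protocol A B Z,
      ∀ b ∈ l, π.eval a b = (F a b).getD z0 := by
    intro a l
    induction l with
    | nil => exact ⟨leaf z0, by simp⟩
    | cons b0 l ih =>
      obtain ⟨π, hπ⟩ := ih
      refine ⟨bob (fun b => decide (b = b0)) π (leaf ((F a b0).getD z0)), ?_⟩
      intro b hb
      by_cases h : b = b0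
      · subst h; simp [eval]
      · have hb' : b ∈ l := by simpa [h] using hb
        simpa [eval, h] using hπ b hb'
  have hA : ∀ l : List A, ∃ π : Protocol A B Z,
      ∀ a ∈ l, ∀ b, π.eval a b = (F a b).getD z0 := by
    intro l
    induction l with
    | nil => exact ⟨leaf z0, by simp⟩
    | cons a0 l ih =>
      obtain ⟨π, hπ⟩ := ih
      obtain ⟨ρ, hρ⟩ := hB a0 Finset.univ.toList
      refine ⟨alice (fun a => decide (a = a0)) π ρ, ?_⟩
      intro a ha b
      by_cases h : a = a0
      · subst h; simpa [eval] using hρ b (by simp)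
      · have ha' : a ∈ l := by simpa [h] using ha
        simpa [eval, h] using hπ a ha' b
  obtain ⟨π, hπ⟩ := hA Finset.univ.toList
  refine ⟨π, fun a b z hz => ?_⟩
  rw [hπ a (by simp) b, hz]
  rfl

end Protocol

/-- The deterministic communication complexity of a (possibly partial) function: the smallest
height of a protocol that computes it. -/
noncomputable def Dcc {A B : Type} {Z : Type*} (F : A → B → Option Z) : ℕ :=
  sInf {k | ∃ π : Protocol A B Z, π.Computes F ∧ π.height = k}

/-- Deterministic decision trees on `p` Boolean variables with outputs in `Z`. The first subtree
is entered when the queried bit is 0, the second one when it is 1. -/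
inductive DecisionTree (p : ℕ) (Z : Type*) where
  | leaf (z : Z) : DecisionTree p Z
  | query (i : Fin p) (child0 child1 : DecisionTree p Z) : DecisionTree p Z

namespace DecisionTree

/-- The output of the execution of a decision tree on the input `z`. -/
def eval {p : ℕ} {Z : Type*} : DecisionTree p Z → (Fin p → Bool) → Z
  | leaf w, _ => w
  | query i c0 c1, z => if z i then c1.eval z else c0.eval z

/-- The query complexity of a decision tree: its height. -/
def height {p : ℕ} {Z : Type*} : DecisionTree p Z → ℕ
  | leaf _ => 0
  | query _ c0 c1 => max c0.height c1.height + 1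

/-- The decision tree computes `f`: it is correct on every input. -/
def Computes {p : ℕ} {Z : Type*} (T : DecisionTree p Z) (f : (Fin p → Bool) → Z) : Prop :=
  ∀ z, T.eval z = f z

/-- Every function has a decision tree, so that the infimum in the definition of the query
complexity is taken over a non-empty set. -/
theorem exists_computes {p : ℕ} {Z : Type*} (f : (Fin p → Bool) → Z) :
    ∃ T : DecisionTree p Z, T.Computes f := by
  have h : ∀ (l : List (Fin p)) (w : Fin p → Bool), ∃ T : DecisionTree p Z,
      ∀ z, (∀ i, i ∉ l → z i = w i) → T.eval z = f z := by
    intro l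
    induction l with
    | nil =>
      intro w
      refine ⟨leaf (f w), fun z hz => ?_⟩
      have : z = w := funext fun i => hz i (by simp)
      rw [this]; rfl
    | cons j l ih =>
      intro w
      obtain ⟨T0, h0⟩ := ih (Function.update w j false)
      obtain ⟨T1, h1⟩ := ih (Function.update w j true)
      refine ⟨query j T0 T1, fun z hz => ?_⟩
      have key : ∀ c, z j = c → ∀ i, i ∉ l → z i = Function.update w j c i := by
        intro c hc i hi
        by_cases hij : i = j
        · subst hij; simpa using hc
        · rw [Function.update_of_ne hij]
          exact hz i (by simp [hij, hi])
      by_cases hj : z j = true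
      · simpa [eval, hj] using h1 z (key true hj)
      · have hj' : z j = false := by simpa using hj
        simpa [eval, hj'] using h0 z (key false hj')
  obtain ⟨T, hT⟩ := h (List.finRange p) (fun _ => false)
  exact ⟨T, fun z => hT z (fun i hi => absurd (List.mem_finRange i) hi)⟩

end DecisionTree

/-- The deterministic query complexity of `f`: the smallest height of a decision tree that
computes it. -/
noncomputable def Ddt {p : ℕ} {Z : Type*} (f : (Fin p → Bool) → Z) : ℕ :=
  sInf {k | ∃ T : DecisionTree p Z, T.Computes f ∧ T.height = k}

/-- The composed function `f ∘ g^p` for a (possibly partial) gadget `g`. Alice holds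
`x = (x_1, …, x_p)`, Bob holds `y = (y_1, …, y_p)`, and the value is
`f (g (x_1, y_1), …, g (x_p, y_p))`; it is defined exactly when every `g (x_i, y_i)` is. -/
def composeGadget {p : ℕ} {X Y : Type} {Z : Type*} (f : (Fin p → Bool) → Z)
    (g : X → Y → Option Bool) : (Fin p → X) → (Fin p → Y) → Option Z :=
  fun x y =>
    if h : ∀ i, (g (x i) (y i)).isSome = true then
      some (f fun i => (g (x i) (y i)).get (h i))
    else none

/-- The inner-product function on `n` bits, `∑ x_i y_i mod 2` (a total function). -/
def innerProductGadget (n : ℕ) : (Fin n → Bool) → (Fin n → Bool) → Option Bool :=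
  fun x y => some (decide ((∑ i, (x i).toNat * (y i).toNat) % 2 = 1))

/-- `g` is the gap-Hamming problem with parameter `γ` on `n`-bit strings: it is defined exactly on
the pairs at Hamming distance at least `(1/2 + γ) n` or at most `(1/2 - γ) n`, it takes the value 1
only on pairs of the first kind, and the value 0 only on pairs of the second kind. For `γ > 0` and
`n ≥ 1` there is exactly one such `g`. For `γ = 0` a pair at distance exactly `n / 2` is of both
kinds, and either value is allowed there. -/
def IsGapHamming (n : ℕ) (γ : ℝ) (g : (Fin n → Bool) → (Fin n → Bool) → Option Bool) : Prop :=
  ∀ x y,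
    ((g x y).isSome = true ↔
      (1 / 2 + γ) * n ≤ (hammingDist x y : ℝ) ∨ (hammingDist x y : ℝ) ≤ (1 / 2 - γ) * n) ∧
    (g x y = some true → (1 / 2 + γ) * n ≤ (hammingDist x y : ℝ)) ∧
    (g x y = some false → (hammingDist x y : ℝ) ≤ (1 / 2 - γ) * n)

/-! The upper bound is direct: follow a decision tree, Alice sending `x_i` and Bob answering with
the gadget value, for `n + 1` bits per query.

For the lower bound a protocol is turned into a decision tree. Down the protocol one keeps non-empty
thick sets `A`, `B` of inputs on the coordinates not yet queried, with the density of `A × B` as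
potential. If the speaker's set has average degree at least `4pτ|X|` in every direction, a bit costs
at most a factor 4: 2 for the majority value of the bit and 2 for restoring thickness
(`exists_thick_subset_eq`). If the degree is smaller in direction `i`, the tree queries `i`:
forgetting that coordinate raises the density by `1/(4pτ)`, and for either answer `b` some
`b`-monochromatic rectangle keeps half of each projection (`HasHitting.exists_restrictCoord`), so
the net gain is `1/(16pτ) ≥ 2^K`. At a leaf all values of the remaining gadgets still occur
(`HasHitting.exists_eq`), so the output of the leaf is correct. As densities never exceed 1, `K`
times the number of queries is at most twice the number of bits.

It remains to find hitting distributions with `τ = (1000/1007)^n`, which allows `K = n / 800`. For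
gap-Hamming these are balls of radius `n/8` around a random point and around the same point or its
antipode; they hit by concentration of measure (`card_far_le`). For the inner product they are
graphs given by a random matrix and its transpose, which hit by pairwise independence
(`card_matrix_missed_le`). Small `n` is absorbed in the constant, since `p` is then bounded. -/

open Finset

/-! ### Decision trees and restrictions -/

namespace DecisionTree

/-- Renaming the variables of a decision tree. -/
def reindex {m k : ℕ} {Z : Type*} (e : Fin m → Fin k) : DecisionTree m Z → DecisionTree k Z
  | leaf w => leaf w
  | query i c0 c1 => query (e i) (c0.reindex e) (c1.reindex e)

theorem eval_reindex {m k : ℕ} {Z : Type*} (e : Fin m → Fin k) (T : DecisionTree m Z)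
    (z : Fin k → Bool) : (T.reindex e).eval z = T.eval fun i => z (e i) := by
  induction T with
  | leaf w => rfl
  | query i c0 c1 h0 h1 => simp [reindex, eval, h0, h1]

theorem height_reindex {m k : ℕ} {Z : Type*} (e : Fin m → Fin k) (T : DecisionTree m Z) :
    (T.reindex e).height = T.height := by
  induction T with
  | leaf w => rfl
  | query i c0 c1 h0 h1 => simp [reindex, height, h0, h1]

/-- Query the variable `i` and continue with a tree for the corresponding restriction. -/
theorem exists_query {m : ℕ} {Z : Type*} (f : (Fin (m + 1) → Bool) → Z) (i : Fin (m + 1))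
    (T : Bool → DecisionTree m Z)
    (hT : ∀ b, (T b).Computes fun z => f (i.insertNth b z)) :
    ∃ S : DecisionTree (m + 1) Z, S.Computes f ∧ ∃ b, S.height = (T b).height + 1 := by
  refine ⟨query i ((T false).reindex i.succAbove) ((T true).reindex i.succAbove), ?_, ?_⟩
  · intro z
    have key : ∀ b, z i = b → (T b).eval (fun j => z (i.succAbove j)) = f z := by
      intro b hb
      rw [hT b, ← hb]
      exact congrArg f (Fin.insertNth_self_removeNth i z)
    by_cases h : z i = true
    · simpa [eval, h, eval_reindex] using key true h
    · have h' : z i = false := by simpa using h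
      simpa [eval, h', eval_reindex] using key false h'
  · simp only [height, height_reindex]
    rcases le_total (T false).height (T true).height with h | h
    · exact ⟨true, by rw [max_eq_right h]⟩
    · exact ⟨false, by rw [max_eq_left h]⟩

end DecisionTree

/-! ### Thick sets and hitting rectangle distributions -/

/-- Every element of `A` has, in each direction, at least `τ * |X|` neighbours in `A`. -/
def Thick {m : ℕ} {X : Type} [Fintype X] [DecidableEq X] (τ : ℝ) (A : Finset (Fin m → X)) : Prop :=
  ∀ i, ∀ x ∈ A, τ * Fintype.card X ≤ #{a | Function.update x i a ∈ A}

/-- For each `b` there is a distribution on `b`-monochromatic rectangles whose sides intersect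
every fixed set of density `τ` with probability at least `3/4`. -/
def HasHitting {X Y : Type} [Fintype X] [DecidableEq X] [Fintype Y] [DecidableEq Y]
    (g : X → Y → Option Bool) (τ : ℝ) : Prop :=
  ∀ b, ∃ (Ω : Type) (_ : Fintype Ω) (_ : Nonempty Ω) (U : Ω → Finset X) (V : Ω → Finset Y),
    (∀ ω, ∀ x ∈ U ω, ∀ y ∈ V ω, g x y = some b) ∧
    (∀ S : Finset X, τ * Fintype.card X ≤ #S →
      4 * #{ω | Disjoint S (U ω)} ≤ Fintype.card Ω) ∧
    (∀ S : Finset Y, τ * Fintype.card Y ≤ #S →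
      4 * #{ω | Disjoint S (V ω)} ≤ Fintype.card Ω)

/-! ### Restricting one coordinate of thick sets -/

section Projection

variable {m : ℕ} {X Y : Type} [Fintype X] [DecidableEq X] [Fintype Y] [DecidableEq Y]

/-- The elements that can be extended to an element of `A` by a coordinate `i` in `U`. -/
def restrictCoord (A : Finset (Fin (m + 1) → X)) (i : Fin (m + 1)) (U : Finset X) :
    Finset (Fin m → X) :=
  {x | ∃ a ∈ U, i.insertNth a x ∈ A}

/-- Moving in another direction leaves coordinate `i` alone, so the same witness `a ∈ U` serves all
neighbours. -/
theorem Thick.restrictCoord {τ : ℝ} {A : Finset (Fin (m + 1) → X)} (hA : Thick τ A)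
    (i : Fin (m + 1)) (U : Finset X) : Thick τ (restrictCoord A i U) := by
  intro j x hx
  obtain ⟨a, haU, ha⟩ := (mem_filter.1 hx).2
  refine (hA (i.succAbove j) _ ha).trans ?_
  norm_cast
  refine card_le_card fun c hc => ?_
  simp only [mem_filter, mem_univ, true_and, _root_.restrictCoord] at hc ⊢
  refine ⟨a, haU, ?_⟩
  rwa [Fin.insertNth_update]

/-- The elements of the projection of `A` that the restriction to `U` loses. -/
theorem card_image_sub_restrictCoord (A : Finset (Fin (m + 1) → X)) (i : Fin (m + 1))
    (U : Finset X) :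
    #(A.image i.removeNth) ≤ #(restrictCoord A i U) +
      #{x ∈ A.image i.removeNth | Disjoint ({a | i.insertNth a x ∈ A} : Finset X) U} := by
  refine le_trans (card_le_card ?_) (card_union_le _ _)
  intro x hx
  by_cases h : Disjoint ({a | i.insertNth a x ∈ A} : Finset X) U
  · exact mem_union_right _ (mem_filter.2 ⟨hx, h⟩)
  · obtain ⟨a, ha, haU⟩ := not_disjoint_iff.1 h
    refine mem_union_left _ ?_
    simp only [mem_filter, mem_univ, true_and, restrictCoord] at ha ⊢
    exact ⟨a, haU, ha⟩

/-- Double counting: by thickness the fibre over each point of the projection has density `τ`, so at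
most a quarter of the `ω` miss it. -/
theorem sum_card_missed_le {Ω : Type} [Fintype Ω] {τ : ℝ} {A : Finset (Fin (m + 1) → X)}
    (hA : Thick τ A) (i : Fin (m + 1)) (U : Ω → Finset X)
    (hU : ∀ S : Finset X, τ * Fintype.card X ≤ #S →
      4 * #{ω | Disjoint S (U ω)} ≤ Fintype.card Ω) :
    4 * ∑ ω, #{x ∈ A.image i.removeNth | Disjoint ({a | i.insertNth a x ∈ A} : Finset X) (U ω)}
      ≤ #(A.image i.removeNth) * Fintype.card Ω := by
  have := Finset.sum_card_bipartiteAbove_eq_sum_card_bipartiteBelow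
    (s := (univ : Finset Ω)) (t := A.image i.removeNth)
    (fun ω x => Disjoint ({a | i.insertNth a x ∈ A} : Finset X) (U ω))
  simp only [bipartiteAbove, bipartiteBelow] at this
  rw [this, mul_sum]
  rw [← smul_eq_mul]
  refine sum_le_card_nsmul _ _ _ fun x hx => hU _ ?_
  obtain ⟨y, hy, rfl⟩ := mem_image.1 hx
  refine (hA i y hy).trans ?_
  norm_cast
  refine card_le_card fun c hc => ?_
  simpa using hc

/-- A monochromatic rectangle to which one coordinate of two thick sets can be restricted at the
cost of at most half of the projections. -/
theorem HasHitting.exists_restrictCoord {g : X → Y → Option Bool} {τ : ℝ} (hg : HasHitting g τ)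
    {A : Finset (Fin (m + 1) → X)} {B : Finset (Fin (m + 1) → Y)} (hA : Thick τ A)
    (hB : Thick τ B) (hA0 : A.Nonempty) (hB0 : B.Nonempty) (i : Fin (m + 1)) (b : Bool) :
    ∃ (U : Finset X) (V : Finset Y), (∀ x ∈ U, ∀ y ∈ V, g x y = some b) ∧
      #(A.image i.removeNth) ≤ 2 * #(restrictCoord A i U) ∧
      #(B.image i.removeNth) ≤ 2 * #(restrictCoord B i V) := by
  obtain ⟨Ω, _, _, U, V, hmono, hU, hV⟩ := hg b
  have h1 := sum_card_missed_le hA i U hU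
  have h2 := sum_card_missed_le hB i V hV
  have hA1 : 0 < #(A.image i.removeNth) := card_pos.2 (hA0.image _)
  have hB1 : 0 < #(B.image i.removeNth) := card_pos.2 (hB0.image _)
  set α := #(A.image i.removeNth)
  set β := #(B.image i.removeNth)
  set u : Ω → ℕ := fun ω =>
    #{x ∈ A.image i.removeNth | Disjoint ({a | i.insertNth a x ∈ A} : Finset X) (U ω)} with hu
  set v : Ω → ℕ := fun ω =>
    #{x ∈ B.image i.removeNth | Disjoint ({a | i.insertNth a x ∈ B} : Finset Y) (V ω)} with hv
  -- The two losses are averaged together, each weighted by the size of the other projection: an `ω`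
  -- with `2(uβ + vα) ≤ αβ` satisfies both `2u ≤ α` and `2v ≤ β`.
  have h3 : ∑ ω, (2 * (u ω * β + v ω * α)) ≤ ∑ _ω : Ω, α * β := by
    rw [← mul_sum, sum_add_distrib, ← sum_mul, ← sum_mul, sum_const, card_univ, smul_eq_mul]
    nlinarith
  obtain ⟨ω, -, hω⟩ := exists_le_of_sum_le univ_nonempty h3
  refine ⟨U ω, V ω, hmono ω, ?_, ?_⟩
  · have h4 := card_image_sub_restrictCoord A i (U ω)
    change α ≤ _ + u ω at h4
    have : 2 * u ω ≤ α := by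
      by_contra h
      nlinarith
    change α ≤ _
    omega
  · have h4 := card_image_sub_restrictCoord B i (V ω)
    change β ≤ _ + v ω at h4
    have : 2 * v ω ≤ β := by
      by_contra h
      nlinarith
    change β ≤ _
    omega

/-- On non-empty thick sets every value of `g^m` is attained. -/
theorem HasHitting.exists_eq {g : X → Y → Option Bool} {τ : ℝ} (hg : HasHitting g τ) :
    ∀ (m : ℕ) (A : Finset (Fin m → X)) (B : Finset (Fin m → Y)), Thick τ A → Thick τ B →
      A.Nonempty → B.Nonempty → ∀ z : Fin m → Bool,
      ∃ x ∈ A, ∃ y ∈ B, ∀ i, g (x i) (y i) = some (z i) := by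
  intro m
  induction m with
  | zero =>
    rintro A B - - ⟨x, hx⟩ ⟨y, hy⟩ z
    exact ⟨x, hx, y, hy, fun i => i.elim0⟩
  | succ m ih =>
    intro A B hA hB hA0 hB0 z
    obtain ⟨U, V, hmono, hAU, hBV⟩ := hg.exists_restrictCoord hA hB hA0 hB0 0 (z 0)
    have hA1 := card_pos.2 (hA0.image (Fin.removeNth 0))
    have hB1 := card_pos.2 (hB0.image (Fin.removeNth 0))
    obtain ⟨x, hx, y, hy, hxy⟩ := ih _ _ (hA.restrictCoord 0 U) (hB.restrictCoord 0 V)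
      (card_pos.1 (by omega)) (card_pos.1 (by omega)) (fun i => z i.succ)
    obtain ⟨a, haU, ha⟩ := (mem_filter.1 hx).2
    obtain ⟨b, hbV, hb⟩ := (mem_filter.1 hy).2
    refine ⟨_, ha, _, hb, fun i => ?_⟩
    refine Fin.cases ?_ (fun j => ?_) i
    · simpa using hmono a haU b hbV
    · simpa using hxy j

end Projection

/-! ### Thick subsets -/

section Thickening

variable {m : ℕ} {X : Type} [DecidableEq X]

/-- The projection of `A` that forgets the coordinate `i`. -/
def dropCoord (i : Fin m) (A : Finset (Fin m → X)) : Finset ({j // j ≠ i} → X) :=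
  A.image fun x j => x j

/-- `dropCoord` makes sense for every `m`, including 0, while the induction on dimension uses
`removeNth`; the two differ by a relabelling of coordinates. -/
theorem card_dropCoord_succ (i : Fin (m + 1)) (A : Finset (Fin (m + 1) → X)) :
    #(dropCoord i A) = #(A.image i.removeNth) := by
  have : A.image i.removeNth =
      (dropCoord i A).image fun x (k : Fin m) => x ⟨i.succAbove k, Fin.succAbove_ne i k⟩ := by
    rw [dropCoord, image_image]; rfl
  rw [this, card_image_of_injective]
  intro x y h
  funext ⟨j, hj⟩
  obtain ⟨k, rfl⟩ := Fin.exists_succAbove_eq hj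
  exact congrFun h k

variable [Fintype X]

/-- A set with few elements in its projections, relative to its size, has a large thick subset. -/
theorem exists_thick_subset {τ : ℝ} (hτ : 0 ≤ τ) (A : Finset (Fin m → X)) :
    ∃ A' ⊆ A, Thick τ A' ∧
      (#A : ℝ) ≤ #A' + ∑ i, τ * Fintype.card X * #(dropCoord i A) := by
  set s : ℝ := τ * Fintype.card X with hs
  have hs0 : 0 ≤ s := by positivity
  -- Extremal choice in place of iterated deletion: removing a fibre with fewer than `s` points
  -- costs less than `s` but shrinks one projection, which gains at least `s`. A maximiser thus has
  -- no such fibre, and comparing it with `A` gives the size bound.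
  obtain ⟨A', hA', hmax⟩ := exists_max_image A.powerset
    (fun A' => (#A' : ℝ) - ∑ i, s * #(dropCoord i A')) ⟨A, mem_powerset_self A⟩
  rw [mem_powerset] at hA'
  refine ⟨A', hA', ?_, ?_⟩
  · intro i x hx
    by_contra! hlt
    rw [← hs] at hlt
    set F : Finset (Fin m → X) := {y ∈ A' | ∀ j ≠ i, y j = x j} with hF
    have hFcard : (#F : ℝ) < s := by
      refine lt_of_le_of_lt ?_ hlt
      norm_cast
      refine card_le_card_of_injOn (fun y => y i) ?_ ?_
      · intro y hy
        rw [mem_coe, hF, mem_filter] at hy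
        have : Function.update x i (y i) = y := by
          funext j
          by_cases hj : j = i
          · subst hj; simp
          · rw [Function.update_of_ne hj, hy.2 j hj]
        simp [this, hy.1]
      · intro y hy y' hy' h
        rw [mem_coe, hF, mem_filter] at hy hy'
        funext j
        by_cases hj : j = i
        · subst hj; exact h
        · rw [hy.2 j hj, hy'.2 j hj]
    have hFsub : F ⊆ A' := filter_subset _ _
    have h1 := hmax (A' \ F) (mem_powerset.2 (sdiff_subset.trans hA'))
    have h2 : (#(A' \ F) : ℝ) = #A' - #F := by
      rw [card_sdiff_of_subset hFsub, Nat.cast_sub (card_le_card hFsub)]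
    have h3 : ∑ j, s * (#(dropCoord j (A' \ F)) : ℝ) + s ≤ ∑ j, s * (#(dropCoord j A') : ℝ) := by
      rw [← add_sum_erase _ _ (mem_univ i), ← add_sum_erase univ (fun j => s * (#(dropCoord j A') : ℝ))
        (mem_univ i)]
      have h4 : ∑ j ∈ univ.erase i, s * (#(dropCoord j (A' \ F)) : ℝ) ≤
          ∑ j ∈ univ.erase i, s * (#(dropCoord j A') : ℝ) := by
        refine sum_le_sum fun j _ => mul_le_mul_of_nonneg_left ?_ hs0
        exact_mod_cast card_le_card (image_subset_image sdiff_subset)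
      have h5 : #(dropCoord i (A' \ F)) + 1 ≤ #(dropCoord i A') := by
        refine card_lt_card ((ssubset_iff_of_subset (image_subset_image sdiff_subset)).2
          ⟨_, mem_image_of_mem _ hx, ?_⟩)
        rintro h
        obtain ⟨y, hy, hyx⟩ := mem_image.1 h
        rw [mem_sdiff] at hy
        exact hy.2 (mem_filter.2 ⟨hy.1, fun j hj => congrFun hyx ⟨j, hj⟩⟩)
      have h6 : (#(dropCoord i (A' \ F)) : ℝ) + 1 ≤ #(dropCoord i A') := by exact_mod_cast h5
      nlinarith
    linarith
  · have h1 := hmax A (mem_powerset_self A)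
    have h2 : 0 ≤ ∑ i, s * (#(dropCoord i A') : ℝ) :=
      sum_nonneg fun i _ => mul_nonneg hs0 (Nat.cast_nonneg _)
    linarith

/-- A set of large average degrees in all directions has, for every Boolean function, a thick
subset of at least a quarter of its size on which the function is constant. -/
theorem exists_thick_subset_eq {τ : ℝ} {p : ℕ} (hτ : 0 ≤ τ) (hm : m ≤ p) {A : Finset (Fin m → X)}
    (hA : A.Nonempty) (hdeg : ∀ i, 4 * p * τ * Fintype.card X * #(dropCoord i A) ≤ #A)
    (q : (Fin m → X) → Bool) :
    ∃ b, ∃ A' ⊆ A, (∀ x ∈ A', q x = b) ∧ Thick τ A' ∧ A'.Nonempty ∧ #A ≤ 4 * #A' := by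
  obtain ⟨b, hb⟩ : ∃ b, #A ≤ 2 * #{x ∈ A | q x = b} := by
    have h := card_filter_add_card_filter_not (s := A) (fun x => q x = true)
    simp only [Bool.not_eq_true] at h
    by_cases h' : #A ≤ 2 * #{x ∈ A | q x = true}
    · exact ⟨_, h'⟩
    · exact ⟨false, by omega⟩
  obtain ⟨A', hA', hthick, hcard⟩ := exists_thick_subset hτ {x ∈ A | q x = b}
  -- Thickening loses at most `#A / 4` of the majority half, which leaves a quarter.
  have hsum : 4 * ∑ i, τ * Fintype.card X * (#(dropCoord i {x ∈ A | q x = b}) : ℝ) ≤ #A := by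
    rcases Nat.eq_zero_or_pos m with rfl | hm0
    · simp only [univ_eq_empty, sum_empty, mul_zero]
      positivity
    have hp : (0 : ℝ) < p := by exact_mod_cast hm0.trans_le hm
    have h1 : ∀ i, τ * Fintype.card X * (#(dropCoord i {x ∈ A | q x = b}) : ℝ) ≤ #A / (4 * p) := by
      intro i
      rw [le_div_iff₀ (by positivity)]
      have : (#(dropCoord i {x ∈ A | q x = b}) : ℝ) ≤ #(dropCoord i A) := by
        exact_mod_cast card_le_card (image_subset_image (filter_subset _ _))
      calc _ ≤ τ * Fintype.card X * (#(dropCoord i A) : ℝ) * (4 * p) := by gcongr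
        _ ≤ _ := by linarith [hdeg i]
    have h2 := sum_le_card_nsmul univ _ _ fun i _ => h1 i
    rw [card_univ, Fintype.card_fin, nsmul_eq_mul] at h2
    have h3 : (m : ℝ) * (#A / (4 * p)) ≤ p * (#A / (4 * p)) := by gcongr
    have h4 : (p : ℝ) * (#A / (4 * p)) = #A / 4 := by field_simp
    linarith
  have hfin : #A ≤ 4 * #A' := by
    have hb' : (#A : ℝ) ≤ 2 * #{x ∈ A | q x = b} := by exact_mod_cast hb
    have : (#A : ℝ) ≤ 4 * #A' := by linarith
    exact_mod_cast this
  have := hA.card_pos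
  exact ⟨b, A', hA'.trans (filter_subset _ _), fun x hx => (mem_filter.1 (hA' hx)).2, hthick,
    card_pos.1 (by omega), hfin⟩

end Thickening

/-! ### From protocols to decision trees -/

section Simulation

variable {P Q X Y : Type} [Fintype X] [DecidableEq X] [Fintype Y] [DecidableEq Y] {Z : Type*}

/-- On thick sets, whenever a function `Φ` (evaluated on lifted inputs) computes `f ∘ g^m`, there
is a decision tree for `f` whose height is controlled by `H` and the densities of the sets. -/
def Simulates (g : X → Y → Option Bool) (τ : ℝ) (K : ℕ) (Φ : P → Q → Z) (H : ℝ) (m : ℕ) : Prop :=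
  ∀ (f : (Fin m → Bool) → Z) (A : Finset (Fin m → X)) (B : Finset (Fin m → Y))
    (L : (Fin m → X) → P) (M : (Fin m → Y) → Q), A.Nonempty → B.Nonempty → Thick τ A → Thick τ B →
    (∀ x ∈ A, ∀ y ∈ B, ∀ z, (∀ i, g (x i) (y i) = some (z i)) → Φ (L x) (M y) = f z) →
    ∃ T : DecisionTree m Z, T.Computes f ∧
      2 ^ (K * T.height) * (#A * #B : ℝ) ≤ H * (Fintype.card X ^ m * Fintype.card Y ^ m)

theorem card_le_card_mul_card_image_removeNth {m : ℕ} (A : Finset (Fin (m + 1) → X))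
    (i : Fin (m + 1)) : #A ≤ Fintype.card X * #(A.image i.removeNth) := by
  rw [← card_univ, ← card_product]
  refine card_le_card_of_injOn (fun x => (x i, i.removeNth x)) ?_ ?_
  · intro x hx
    simpa using ⟨x, hx, rfl⟩
  · intro x _ y _ h
    simp only [Prod.mk.injEq] at h
    rw [← Fin.insertNth_self_removeNth i x, ← Fin.insertNth_self_removeNth i y, h.1, h.2]

/-- The query step: `hi` says that forgetting coordinate `i` raises the density by `1/(4pτ)`;
restricting both sides to a rectangle costs 4, and `hK` leaves a gain of `2^K`, which pays for the
query. -/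
theorem Simulates.query {g : X → Y → Option Bool} {τ : ℝ} {K p m : ℕ} {Φ : P → Q → Z} {H : ℝ}
    (hg : HasHitting g τ) (hτ : 0 ≤ τ) (hK : 2 ^ K * (16 * p * τ) ≤ 1)
    (hm : Simulates g τ K Φ H m) (f : (Fin (m + 1) → Bool) → Z)
    (A : Finset (Fin (m + 1) → X)) (B : Finset (Fin (m + 1) → Y))
    (L : (Fin (m + 1) → X) → P) (M : (Fin (m + 1) → Y) → Q) (hA0 : A.Nonempty) (hB0 : B.Nonempty)
    (hA : Thick τ A) (hB : Thick τ B)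
    (hΦ : ∀ x ∈ A, ∀ y ∈ B, ∀ z, (∀ i, g (x i) (y i) = some (z i)) → Φ (L x) (M y) = f z)
    (i : Fin (m + 1))
    (hi : (#A * #B : ℝ) ≤ 4 * p * τ * (Fintype.card X * Fintype.card Y) *
      (#(A.image i.removeNth) * #(B.image i.removeNth))) :
    ∃ T : DecisionTree (m + 1) Z, T.Computes f ∧
      2 ^ (K * T.height) * (#A * #B : ℝ) ≤
        H * (Fintype.card X ^ (m + 1) * Fintype.card Y ^ (m + 1)) := by
  have key : ∀ b, ∃ T : DecisionTree m Z, (T.Computes fun z => f (i.insertNth b z)) ∧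
      2 ^ (K * T.height) * (#(A.image i.removeNth) * #(B.image i.removeNth) : ℝ) ≤
        4 * (H * (Fintype.card X ^ m * Fintype.card Y ^ m)) := by
    intro b
    obtain ⟨U, V, hmono, hAU, hBV⟩ := hg.exists_restrictCoord hA hB hA0 hB0 i b
    have hA1 := card_pos.2 (hA0.image i.removeNth)
    have hB1 := card_pos.2 (hB0.image i.removeNth)
    -- The lift to the protocol's inputs must be a total function; outside the restricted set the
    -- chosen coordinate is arbitrary.
    have hextA : ∀ x : Fin m → X, ∃ a, x ∈ restrictCoord A i U → a ∈ U ∧ i.insertNth a x ∈ A := by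
      intro x
      by_cases hx : x ∈ restrictCoord A i U
      · obtain ⟨a, h⟩ := (mem_filter.1 hx).2
        exact ⟨a, fun _ => h⟩
      · obtain ⟨x0, -⟩ := hA0
        exact ⟨x0 i, fun h => absurd h hx⟩
    have hextB : ∀ y : Fin m → Y, ∃ a, y ∈ restrictCoord B i V → a ∈ V ∧ i.insertNth a y ∈ B := by
      intro y
      by_cases hy : y ∈ restrictCoord B i V
      · obtain ⟨a, h⟩ := (mem_filter.1 hy).2
        exact ⟨a, fun _ => h⟩
      · obtain ⟨y0, -⟩ := hB0
        exact ⟨y0 i, fun h => absurd h hy⟩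
    choose extA hextA using hextA
    choose extB hextB using hextB
    obtain ⟨T, hT, hcard⟩ := hm (fun z => f (i.insertNth b z)) (restrictCoord A i U)
      (restrictCoord B i V) (fun x => L (i.insertNth (extA x) x))
      (fun y => M (i.insertNth (extB y) y)) (card_pos.1 (by omega)) (card_pos.1 (by omega))
      (hA.restrictCoord i U) (hB.restrictCoord i V) (by
        intro x hx y hy z hz
        refine hΦ _ (hextA x hx).2 _ (hextB y hy).2 _ fun j => ?_
        refine Fin.succAboveCases i ?_ (fun k => ?_) j
        · simpa using hmono _ (hextA x hx).1 _ (hextB y hy).1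
        · simpa using hz k)
    refine ⟨T, hT, ?_⟩
    have h1 : (#(A.image i.removeNth) : ℝ) ≤ 2 * #(restrictCoord A i U) := by exact_mod_cast hAU
    have h2 : (#(B.image i.removeNth) : ℝ) ≤ 2 * #(restrictCoord B i V) := by exact_mod_cast hBV
    calc _ ≤ (2 : ℝ) ^ (K * T.height) *
          ((2 * #(restrictCoord A i U)) * (2 * #(restrictCoord B i V))) := by gcongr
      _ = 4 * (2 ^ (K * T.height) * (#(restrictCoord A i U) * #(restrictCoord B i V))) := by ring
      _ ≤ _ := by gcongr
  choose T hT hcard using key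
  obtain ⟨S, hS, b, hb⟩ := DecisionTree.exists_query f i T hT
  refine ⟨S, hS, ?_⟩
  -- The sign of `H` is not assumed; it follows from the bound for either subtree.
  have hH : 0 ≤ H * ((Fintype.card X : ℝ) ^ m * Fintype.card Y ^ m) := by
    have : (0 : ℝ) ≤ 4 * (H * (Fintype.card X ^ m * Fintype.card Y ^ m)) :=
      le_trans (by positivity) (hcard b)
    linarith
  rw [hb, mul_add, mul_one, pow_add]
  calc (2 : ℝ) ^ (K * (T b).height) * 2 ^ K * (#A * #B)
      ≤ 2 ^ (K * (T b).height) * 2 ^ K * (4 * p * τ * (Fintype.card X * Fintype.card Y) *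
      (#(A.image i.removeNth) * #(B.image i.removeNth))) := by gcongr
    _ = 2 ^ K * (4 * p * τ) * (Fintype.card X * Fintype.card Y) *
      (2 ^ (K * (T b).height) * (#(A.image i.removeNth) * #(B.image i.removeNth))) := by ring
    _ ≤ 2 ^ K * (4 * p * τ) * (Fintype.card X * Fintype.card Y) *
      (4 * (H * (Fintype.card X ^ m * Fintype.card Y ^ m))) := by
        exact mul_le_mul_of_nonneg_left (hcard b) (by positivity)
    _ = 2 ^ K * (16 * p * τ) * (Fintype.card X * Fintype.card Y *
      (H * (Fintype.card X ^ m * Fintype.card Y ^ m))) := by ring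
    _ ≤ 1 * (Fintype.card X * Fintype.card Y *
      (H * (Fintype.card X ^ m * Fintype.card Y ^ m))) := by gcongr
    _ = _ := by ring

/-- Outer induction on the protocol, inner induction on the number of unqueried coordinates: a
communicated bit descends in the protocol, a query lowers `m` at the same node. The lifts `L`, `M`
in `Simulates` let the protocol stay unchanged while coordinates are fixed. -/
theorem simulates_eval {g : X → Y → Option Bool} {τ : ℝ} {K p : ℕ}
    (hg : HasHitting g τ) (hτ : 0 ≤ τ) (hK : 2 ^ K * (16 * p * τ) ≤ 1) (π : Protocol P Q Z) :
    ∀ m ≤ p, Simulates g τ K π.eval (4 ^ π.height) m := by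
  induction π with
  | leaf w =>
    intro m _ f A B L M hA0 hB0 hA hB h
    refine ⟨.leaf w, fun z => ?_, ?_⟩
    -- Every `z` is realised inside `A × B`, so `f` is constant.
    · obtain ⟨x, hx, y, hy, hz⟩ := hg.exists_eq m A B hA hB hA0 hB0 z
      exact h x hx y hy z hz
    · have h1 : (#A : ℝ) ≤ Fintype.card X ^ m := by
        exact_mod_cast (card_le_univ A).trans_eq (by simp)
      have h2 : (#B : ℝ) ≤ Fintype.card Y ^ m := by
        exact_mod_cast (card_le_univ B).trans_eq (by simp)
      simp only [DecisionTree.height, Protocol.height, mul_zero, pow_zero, one_mul]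
      gcongr
  | alice q c0 c1 ih0 ih1 =>
    -- The case of large average degrees: the speaker's bit is fixed on a thick quarter of `A`.
    have key : ∀ m ≤ p, ∀ (f : (Fin m → Bool) → Z) (A : Finset (Fin m → X))
        (B : Finset (Fin m → Y)) (L : (Fin m → X) → P) (M : (Fin m → Y) → Q), A.Nonempty →
        B.Nonempty → Thick τ A → Thick τ B → (∀ x ∈ A, ∀ y ∈ B, ∀ z,
          (∀ i, g (x i) (y i) = some (z i)) → (Protocol.alice q c0 c1).eval (L x) (M y) = f z) →
        (∀ i, 4 * p * τ * Fintype.card X * #(dropCoord i A) ≤ (#A : ℝ)) →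
        ∃ T : DecisionTree m Z, T.Computes f ∧ 2 ^ (K * T.height) * (#A * #B : ℝ) ≤
          4 ^ (Protocol.alice q c0 c1).height * (Fintype.card X ^ m * Fintype.card Y ^ m) := by
      intro m hmp f A B L M hA0 hB0 hA hB h hdeg
      obtain ⟨b, A', hsub, hq, hA', hA'0, hcard⟩ :=
        exists_thick_subset_eq hτ hmp hA0 hdeg fun x => q (L x)
      have hcard' : (#A : ℝ) ≤ 4 * #A' := by exact_mod_cast hcard
      obtain ⟨T, hT, hTcard⟩ : ∃ T : DecisionTree m Z, T.Computes f ∧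
          2 ^ (K * T.height) * (#A' * #B : ℝ) ≤
            4 ^ max c0.height c1.height * (Fintype.card X ^ m * Fintype.card Y ^ m) := by
        cases b
        · obtain ⟨T, hT, hTcard⟩ := ih0 m hmp f A' B L M hA'0 hB0 hA' hB
            fun x hx y hy z hz => by
              have h1 := h x (hsub hx) y hy z hz
              simpa [Protocol.eval, hq x hx] using h1
          refine ⟨T, hT, hTcard.trans ?_⟩
          gcongr
          · norm_num
          · exact le_max_left _ _
        · obtain ⟨T, hT, hTcard⟩ := ih1 m hmp f A' B L M hA'0 hB0 hA' hB
            fun x hx y hy z hz => by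
              have h1 := h x (hsub hx) y hy z hz
              simpa [Protocol.eval, hq x hx] using h1
          refine ⟨T, hT, hTcard.trans ?_⟩
          gcongr
          · norm_num
          · exact le_max_right _ _
      refine ⟨T, hT, ?_⟩
      calc (2 : ℝ) ^ (K * T.height) * (#A * #B : ℝ) ≤ 2 ^ (K * T.height) * ((4 * #A') * #B : ℝ) := by
            gcongr
        _ = 4 * (2 ^ (K * T.height) * (#A' * #B : ℝ)) := by ring
        _ ≤ 4 * (4 ^ max c0.height c1.height * (Fintype.card X ^ m * Fintype.card Y ^ m)) := by
            gcongr
        _ = _ := by rw [Protocol.height, pow_succ]; ring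
    intro m
    induction m with
    | zero =>
      intro hmp f A B L M hA0 hB0 hA hB h
      exact key 0 hmp f A B L M hA0 hB0 hA hB h fun i => i.elim0
    | succ m ihm =>
      intro hmp f A B L M hA0 hB0 hA hB h
      by_cases hdeg : ∀ i, 4 * p * τ * Fintype.card X * #(dropCoord i A) ≤ (#A : ℝ)
      · exact key (m + 1) hmp f A B L M hA0 hB0 hA hB h hdeg
      · push Not at hdeg
        obtain ⟨i, hi⟩ := hdeg
        rw [card_dropCoord_succ] at hi
        have h1 : (#B : ℝ) ≤ Fintype.card Y * #(B.image i.removeNth) := by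
          exact_mod_cast card_le_card_mul_card_image_removeNth B i
        refine (ihm (by omega)).query hg hτ hK f A B L M hA0 hB0 hA hB h i ?_
        calc (#A * #B : ℝ) ≤ (4 * p * τ * Fintype.card X * #(A.image i.removeNth)) *
              (Fintype.card Y * #(B.image i.removeNth)) := by gcongr
          _ = _ := by ring
  | bob q c0 c1 ih0 ih1 =>
    have key : ∀ m ≤ p, ∀ (f : (Fin m → Bool) → Z) (A : Finset (Fin m → X))
        (B : Finset (Fin m → Y)) (L : (Fin m → X) → P) (M : (Fin m → Y) → Q), A.Nonempty →
        B.Nonempty → Thick τ A → Thick τ B → (∀ x ∈ A, ∀ y ∈ B, ∀ z,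
          (∀ i, g (x i) (y i) = some (z i)) → (Protocol.bob q c0 c1).eval (L x) (M y) = f z) →
        (∀ i, 4 * p * τ * Fintype.card Y * #(dropCoord i B) ≤ (#B : ℝ)) →
        ∃ T : DecisionTree m Z, T.Computes f ∧ 2 ^ (K * T.height) * (#A * #B : ℝ) ≤
          4 ^ (Protocol.bob q c0 c1).height * (Fintype.card X ^ m * Fintype.card Y ^ m) := by
      intro m hmp f A B L M hA0 hB0 hA hB h hdeg
      obtain ⟨b, B', hsub, hq, hB', hB'0, hcard⟩ :=
        exists_thick_subset_eq hτ hmp hB0 hdeg fun x => q (M x)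
      have hcard' : (#B : ℝ) ≤ 4 * #B' := by exact_mod_cast hcard
      obtain ⟨T, hT, hTcard⟩ : ∃ T : DecisionTree m Z, T.Computes f ∧
          2 ^ (K * T.height) * (#A * #B' : ℝ) ≤
            4 ^ max c0.height c1.height * (Fintype.card X ^ m * Fintype.card Y ^ m) := by
        cases b
        · obtain ⟨T, hT, hTcard⟩ := ih0 m hmp f A B' L M hA0 hB'0 hA hB'
            fun x hx y hy z hz => by
              have h1 := h x hx y (hsub hy) z hz
              simpa [Protocol.eval, hq y hy] using h1
          refine ⟨T, hT, hTcard.trans ?_⟩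
          gcongr
          · norm_num
          · exact le_max_left _ _
        · obtain ⟨T, hT, hTcard⟩ := ih1 m hmp f A B' L M hA0 hB'0 hA hB'
            fun x hx y hy z hz => by
              have h1 := h x hx y (hsub hy) z hz
              simpa [Protocol.eval, hq y hy] using h1
          refine ⟨T, hT, hTcard.trans ?_⟩
          gcongr
          · norm_num
          · exact le_max_right _ _
      refine ⟨T, hT, ?_⟩
      calc (2 : ℝ) ^ (K * T.height) * (#A * #B : ℝ) ≤ 2 ^ (K * T.height) * (#A * (4 * #B') : ℝ) := by
            gcongr
        _ = 4 * (2 ^ (K * T.height) * (#A * #B' : ℝ)) := by ring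
        _ ≤ 4 * (4 ^ max c0.height c1.height * (Fintype.card X ^ m * Fintype.card Y ^ m)) := by
            gcongr
        _ = _ := by rw [Protocol.height, pow_succ]; ring
    intro m
    induction m with
    | zero =>
      intro hmp f A B L M hA0 hB0 hA hB h
      exact key 0 hmp f A B L M hA0 hB0 hA hB h fun i => i.elim0
    | succ m ihm =>
      intro hmp f A B L M hA0 hB0 hA hB h
      by_cases hdeg : ∀ i, 4 * p * τ * Fintype.card Y * #(dropCoord i B) ≤ (#B : ℝ)
      · exact key (m + 1) hmp f A B L M hA0 hB0 hA hB h hdeg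
      · push Not at hdeg
        obtain ⟨i, hi⟩ := hdeg
        rw [card_dropCoord_succ] at hi
        have h1 : (#A : ℝ) ≤ Fintype.card X * #(A.image i.removeNth) := by
          exact_mod_cast card_le_card_mul_card_image_removeNth A i
        refine (ihm (by omega)).query hg hτ hK f A B L M hA0 hB0 hA hB h i ?_
        calc (#A * #B : ℝ) ≤ (Fintype.card X * #(A.image i.removeNth)) *
              (4 * p * τ * Fintype.card Y * #(B.image i.removeNth)) := by gcongr
          _ = _ := by ring

end Simulation

/-- The simulation theorem: a gadget with hitting monochromatic rectangle distributions turns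
protocols for `f ∘ g^p` into decision trees for `f`. -/
theorem HasHitting.mul_Ddt_le {X Y : Type} [Fintype X] [DecidableEq X] [Fintype Y] [DecidableEq Y]
    [Nonempty X] [Nonempty Y] {Z : Type*} {g : X → Y → Option Bool} {τ : ℝ} {K p : ℕ}
    (hg : HasHitting g τ) (hτ : 0 ≤ τ) (hτ1 : τ ≤ 1) (hK : 2 ^ K * (16 * p * τ) ≤ 1)
    (f : (Fin p → Bool) → Z) : K * Ddt f ≤ 2 * Dcc (composeGadget f g) := by
  have : Nonempty Z := ⟨f fun _ => false⟩
  obtain ⟨π₀, hπ₀⟩ := Protocol.exists_computes (composeGadget f g)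
  obtain ⟨π, hπ, hheight⟩ := Nat.sInf_mem (s := {k | ∃ π : Protocol (Fin p → X) (Fin p → Y) Z,
    π.Computes (composeGadget f g) ∧ π.height = k}) ⟨_, π₀, hπ₀, rfl⟩
  -- The whole space has density 1 and is thick since `τ ≤ 1`.
  obtain ⟨T, hT, hcard⟩ := simulates_eval hg hτ hK π p le_rfl f univ univ id id univ_nonempty
    univ_nonempty (fun i x _ => by simpa using mul_le_of_le_one_left (by positivity) hτ1)
    (fun i x _ => by simpa using mul_le_of_le_one_left (by positivity) hτ1)
    (fun x _ y _ z hz => hπ x y (f z) (by simp [composeGadget, hz]))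
  have h1 : (0 : ℝ) < Fintype.card X ^ p * Fintype.card Y ^ p := by
    have := Fintype.card_pos (α := X)
    have := Fintype.card_pos (α := Y)
    positivity
  simp only [card_univ, Fintype.card_pi_const, Nat.cast_pow] at hcard
  have h2 : (2 : ℝ) ^ (K * T.height) ≤ 2 ^ (2 * π.height) := by
    rw [pow_mul 2 2]
    norm_num
    exact le_of_mul_le_mul_right hcard h1
  have h3 : K * T.height ≤ 2 * π.height := (pow_le_pow_iff_right₀ (by norm_num)).1 h2
  have h4 : Ddt f ≤ T.height := Nat.sInf_le ⟨T, hT, rfl⟩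
  calc K * Ddt f ≤ K * T.height := by gcongr
    _ ≤ 2 * π.height := h3
    _ = _ := by rw [hheight]; rfl

/-! ### Concentration on the cube and gap-Hamming -/

section Hamming

theorem hammingDist_cons {n : ℕ} (c d : Bool) (x y : Fin n → Bool) :
    hammingDist (Fin.cons c x : Fin (n + 1) → Bool) (Fin.cons d y) =
      (if c = d then 0 else 1) + hammingDist x y := by
  simp only [hammingDist, card_filter, Fin.sum_univ_succ, Fin.cons_zero, Fin.cons_succ]
  by_cases h : c = d <;> simp [h]

theorem hammingDist_not {n : ℕ} (x y : Fin n → Bool) :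
    hammingDist x y + hammingDist x (fun i => !y i) = n := by
  simp only [hammingDist, card_filter]
  rw [← sum_add_distrib]
  have h : ∀ i, (if x i ≠ y i then 1 else 0) + (if x i ≠ !y i then 1 else 0) = 1 := by
    intro i
    cases x i <;> cases y i <;> rfl
  rw [sum_congr rfl fun i _ => h i]
  simp

theorem sum_cube_succ {n : ℕ} (F : (Fin (n + 1) → Bool) → ℝ) :
    ∑ x, F x = ∑ x, F (Fin.cons true x) + ∑ x, F (Fin.cons false x) := by
  rw [← (Fin.consEquiv fun _ => Bool).sum_comp, Fintype.sum_prod_type, Fintype.sum_bool]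
  rfl

theorem card_cube_succ {n : ℕ} (A : Finset (Fin (n + 1) → Bool)) :
    #A = #{x | (Fin.cons true x : Fin (n + 1) → Bool) ∈ A} +
      #{x | (Fin.cons false x : Fin (n + 1) → Bool) ∈ A} := by
  have h := sum_cube_succ fun x => if x ∈ A then 1 else 0
  simp only [sum_boole, filter_univ_mem] at h
  exact_mod_cast h

/-- Concentration of measure on the cube, in the form of an exponential moment bound for the
distance to a set. -/
theorem exists_sum_pow_hammingDist_le (n : ℕ) (A : Finset (Fin n → Bool)) (hA : A.Nonempty) :
    ∃ φ : (Fin n → Bool) → (Fin n → Bool), (∀ x, φ x ∈ A) ∧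
      (∑ x, (5 / 4 : ℝ) ^ hammingDist x (φ x)) * #A ≤ (81 / 20) ^ n := by
  induction n with
  | zero =>
    obtain ⟨a, ha⟩ := hA
    refine ⟨fun _ => a, fun _ => ha, ?_⟩
    have : (#A : ℝ) ≤ 1 := by exact_mod_cast card_le_one_of_subsingleton A
    simpa [hammingDist] using this
  | succ n ih =>
    set S : Bool → Finset (Fin n → Bool) :=
      fun b => {x | (Fin.cons b x : Fin (n + 1) → Bool) ∈ A} with hS
    have hmem : ∀ b x, x ∈ S b → (Fin.cons b x : Fin (n + 1) → Bool) ∈ A := by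
      intro b x hx
      simpa [hS] using hx
    obtain ⟨b, hb⟩ : ∃ b, #(S !b) ≤ #(S b) := by
      rcases le_total #(S true) #(S false) with h | h
      · exact ⟨false, h⟩
      · exact ⟨true, h⟩
    have hcard : #A = #(S b) + #(S !b) := by
      rw [card_cube_succ A]
      cases b
      · exact add_comm _ _
      · rfl
    have hsum : ∀ F : (Fin (n + 1) → Bool) → ℝ,
        ∑ x, F x = ∑ x, F (Fin.cons b x) + ∑ x, F (Fin.cons (!b) x) := by
      intro F
      rw [sum_cube_succ F]
      cases b
      · exact add_comm _ _
      · rfl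
    have hb0 : 0 < #(S b) := by
      have := hA.card_pos
      omega
    obtain ⟨φ, hφ, hφs⟩ := ih (S b) (card_pos.1 hb0)
    have hb0' : (0 : ℝ) < #(S b) := by exact_mod_cast hb0
    have hb' : (#(S !b) : ℝ) ≤ #(S b) := by exact_mod_cast hb
    have hM : (0 : ℝ) < (81 / 20) ^ n := by positivity
    -- If one half of `A` is much smaller, all points are sent to the larger half, at the price of a
    -- factor `5/4` for those that switch; otherwise each stays on its side. Both estimates give
    -- `81/20`, attained at the ratio `4/5`.
    by_cases h : (5 / 4 : ℝ) * #(S !b) ≤ #(S b)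
    · refine ⟨fun x => Fin.cons b (φ fun i => x i.succ), fun x => hmem _ _ (hφ _), ?_⟩
      rw [hsum, hcard]
      simp only [Fin.cons_succ, hammingDist_cons, if_true, zero_add]
      have hne : (!b) ≠ b := by cases b <;> decide
      simp only [if_neg hne, pow_add, ← mul_sum]
      set s := ∑ x, (5 / 4 : ℝ) ^ hammingDist x (φ x)
      have hs : 0 ≤ s := sum_nonneg fun _ _ => by positivity
      push_cast
      rw [pow_succ]
      nlinarith
    · push Not at h
      have hb1 : (0 : ℝ) < #(S !b) := by nlinarith
      obtain ⟨ψ, hψ, hψs⟩ := ih (S !b) (card_pos.1 (by exact_mod_cast hb1))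
      refine ⟨fun x => Fin.cons (x 0) (if x 0 = b then φ (fun i => x i.succ) else
        ψ fun i => x i.succ), fun x => hmem _ _ ?_, ?_⟩
      · by_cases hx : x 0 = b
        · simpa [hx] using hφ _
        · have hx' : x 0 = !b := by
            revert hx; cases x 0 <;> cases b <;> decide
          have hne : (!b) ≠ b := by cases b <;> decide
          simpa [hx', hne] using hψ _
      rw [hsum, hcard]
      have hne : (!b) ≠ b := by cases b <;> decide
      simp only [Fin.cons_succ, Fin.cons_zero, hammingDist_cons, if_true, zero_add, if_neg hne]
      set s := ∑ x, (5 / 4 : ℝ) ^ hammingDist x (φ x)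
      set t := ∑ x, (5 / 4 : ℝ) ^ hammingDist x (ψ x)
      set u : ℝ := ((#(S b) : ℕ) : ℝ)
      set v : ℝ := ((#(S !b) : ℕ) : ℝ)
      set M : ℝ := (81 / 20) ^ n
      have hs : s ≤ M / u := (le_div_iff₀ hb0').2 hφs
      have ht : t ≤ M / v := (le_div_iff₀ hb1).2 hψs
      have h1 : (M / u + M / v) * (u + v) = M * ((u + v) ^ 2 / (u * v)) := by
        field_simp
        ring
      have h2 : (u + v) ^ 2 / (u * v) ≤ 81 / 20 := by
        rw [div_le_iff₀ (by positivity)]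
        nlinarith [mul_nonneg (sub_nonneg.2 hb') (sub_nonneg.2 h.le)]
      push_cast
      rw [pow_succ]
      calc (s + t) * (u + v) ≤ (M / u + M / v) * (u + v) := by gcongr
        _ = _ := h1
        _ ≤ _ := by gcongr

/-- Most points of the cube are at distance at most `n / 8` from a given large set. -/
theorem card_far_le {n : ℕ} (hn : 1000 ≤ n) (S : Finset (Fin n → Bool))
    (hS : (1000 / 1007 : ℝ) ^ n * Fintype.card (Fin n → Bool) ≤ #S) :
    4 * #{w | Disjoint S ({x | 8 * hammingDist x w ≤ n} : Finset (Fin n → Bool))} ≤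
      Fintype.card (Fin n → Bool) := by
  have hcube : (Fintype.card (Fin n → Bool) : ℝ) = 2 ^ n := by simp
  have hS0 : S.Nonempty := by
    rw [← card_pos]
    have : (0 : ℝ) < #S := lt_of_lt_of_le (by rw [hcube]; positivity) hS
    exact_mod_cast this
  obtain ⟨φ, hφ, hφs⟩ := exists_sum_pow_hammingDist_le n S hS0
  set W : Finset (Fin n → Bool) :=
    {w | Disjoint S ({x | 8 * hammingDist x w ≤ n} : Finset (Fin n → Bool))}
  have h1 : #W * (257 / 250 : ℝ) ^ n ≤ ∑ x, (5 / 4 : ℝ) ^ hammingDist x (φ x) := by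
    rw [← nsmul_eq_mul]
    refine (card_nsmul_le_sum W (fun x => (5 / 4 : ℝ) ^ hammingDist x (φ x)) _ ?_).trans
      (sum_le_univ_sum_of_nonneg fun x => by positivity)
    intro w hw
    have h2 := disjoint_left.1 (mem_filter.1 hw).2 (hφ w)
    simp only [mem_filter, mem_univ, true_and, not_le] at h2
    rw [hammingDist_comm] at h2
    -- Markov's inequality for the exponential moment, with `(257/250)^8 ≤ 5/4`.
    calc (257 / 250 : ℝ) ^ n ≤ (257 / 250) ^ (8 * hammingDist w (φ w)) :=
          pow_le_pow_right₀ (by norm_num) h2.le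
      _ = ((257 / 250) ^ 8) ^ hammingDist w (φ w) := by rw [pow_mul]
      _ ≤ _ := by
        gcongr
        norm_num
  have h3 : 4 * (#W : ℝ) ≤ 2 ^ n := by
    rw [hcube] at hS
    have h4 : #W * (257 / 250 : ℝ) ^ n * ((1000 / 1007 : ℝ) ^ n * 2 ^ n) ≤ (81 / 20) ^ n :=
      le_trans (by gcongr) hφs
    have h5 : (4 : ℝ) * (81 / 20) ^ n ≤
        (257 / 250 : ℝ) ^ n * ((1000 / 1007 : ℝ) ^ n * 2 ^ n) * 2 ^ n := by
      have h6 : (4 : ℝ) ≤ (1 + 1 / 250) ^ n := by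
        have h7 := one_add_mul_le_pow (a := (1 / 250 : ℝ)) (by norm_num) n
        have h8 : (1000 : ℝ) ≤ n := by exact_mod_cast hn
        linarith
      calc (4 : ℝ) * (81 / 20) ^ n ≤ (1 + 1 / 250) ^ n * (81 / 20) ^ n := by gcongr
        _ = ((1 + 1 / 250) * (81 / 20)) ^ n := (mul_pow _ _ _).symm
        _ ≤ (257 / 250 * (1000 / 1007 * 2) * 2) ^ n :=
          pow_le_pow_left₀ (by norm_num) (by norm_num) n
        _ = _ := by simp only [mul_pow]
    have h9 : (0 : ℝ) < (257 / 250 : ℝ) ^ n * ((1000 / 1007 : ℝ) ^ n * 2 ^ n) := by positivity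
    refine le_of_mul_le_mul_right ?_ h9
    linarith
  have : ((4 * #W : ℕ) : ℝ) ≤ (Fintype.card (Fin n → Bool) : ℕ) := by
    rw [hcube]
    push_cast
    exact h3
  exact_mod_cast this

/-- For a uniform centre `w`, two points within `n/8` of `w` are within `n/4` of each other; a point
near `w` and one near its antipode are at distance at least `3n/4`. The antipodal map is a
bijection, so both balls hit equally well. -/
theorem hasHitting_of_hammingDist {n : ℕ} (hn : 1000 ≤ n)
    {g : (Fin n → Bool) → (Fin n → Bool) → Option Bool}
    (h0 : ∀ x y, 4 * hammingDist x y ≤ n → g x y = some false)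
    (h1 : ∀ x y, 3 * n ≤ 4 * hammingDist x y → g x y = some true) :
    HasHitting g ((1000 / 1007) ^ n) := by
  intro b
  cases b
  · refine ⟨Fin n → Bool, inferInstance, inferInstance, fun w => {x | 8 * hammingDist x w ≤ n},
      fun w => {x | 8 * hammingDist x w ≤ n}, ?_, card_far_le hn, card_far_le hn⟩
    intro w x hx y hy
    simp only [mem_filter, mem_univ, true_and] at hx hy
    have := hammingDist_triangle_right x y w
    exact h0 x y (by omega)
  · refine ⟨Fin n → Bool, inferInstance, inferInstance, fun w => {x | 8 * hammingDist x w ≤ n},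
      fun w => {x | 8 * hammingDist x (fun i => !w i) ≤ n}, ?_, card_far_le hn, fun S hS => ?_⟩
    · intro w x hx y hy
      simp only [mem_filter, mem_univ, true_and] at hx hy
      have h2 := hammingDist_triangle_right x w (fun i => !y i)
      have h3 := hammingDist_not x y
      have h4 := hammingDist_not y w
      have h5 := hammingDist_not w y
      have h6 := hammingDist_triangle x w (fun i => !y i)
      have h7 := hammingDist_comm w y
      exact h1 x y (by omega)
    · refine le_trans (Nat.mul_le_mul_left 4 ?_) (card_far_le hn S hS)
      refine card_le_card_of_injOn (fun w i => !w i) (fun w hw => by simpa using hw) ?_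
      intro v _ w _ h
      funext i
      simpa using congrFun h i

/-- As `γ ≤ 1/4`, distances up to `n/4` and from `3n/4` on lie in the domain, and `n > 0` excludes
the wrong value there. -/
theorem IsGapHamming.hasHitting {n : ℕ} (hn : 1000 ≤ n) {γ : ℝ} (hγ0 : 0 ≤ γ) (hγ : γ ≤ 1 / 4)
    {g : (Fin n → Bool) → (Fin n → Bool) → Option Bool} (hg : IsGapHamming n γ g) :
    HasHitting g ((1000 / 1007) ^ n) := by
  have hn' : (0 : ℝ) < n := by
    have : 0 < n := by omega
    exact_mod_cast this
  refine hasHitting_of_hammingDist hn ?_ ?_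
  · intro x y h
    have h' : 4 * (hammingDist x y : ℝ) ≤ n := by exact_mod_cast h
    obtain ⟨hs, ht, -⟩ := hg x y
    obtain ⟨b, hb⟩ := Option.isSome_iff_exists.1 (hs.2 (Or.inr (by nlinarith)))
    cases b
    · exact hb
    · have := ht hb
      nlinarith
  · intro x y h
    have h' : 3 * (n : ℝ) ≤ 4 * hammingDist x y := by exact_mod_cast h
    obtain ⟨hs, -, hf⟩ := hg x y
    obtain ⟨b, hb⟩ := Option.isSome_iff_exists.1 (hs.2 (Or.inl (by nlinarith)))
    cases b
    · have := hf hb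
      nlinarith
    · exact hb

end Hamming

/-! ### Pairwise independence and the inner product -/

section InnerProduct

/-- The second moment method: a random set that contains the elements of `S` pairwise
independently, each with probability `1 / R`, is unlikely to miss all of them if `S` is large. -/
theorem card_missed_mul_card_le {Ω X : Type} [Fintype Ω] (S : Finset X)
    (I : Ω → X → Prop) [∀ ω x, Decidable (I ω x)] {R : ℕ} (hR : 0 < R)
    (h1 : ∀ x ∈ S, #{ω | I ω x} * R = Fintype.card Ω)
    (h2 : ∀ x ∈ S, ∀ y ∈ S, x ≠ y → #{ω | I ω x ∧ I ω y} * R ^ 2 ≤ Fintype.card Ω) :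
    #{ω | ∀ x ∈ S, ¬ I ω x} * #S ≤ Fintype.card Ω * R := by
  classical
  set N : ℝ := ((Fintype.card Ω : ℕ) : ℝ)
  set s : ℝ := ((#S : ℕ) : ℝ) with hs
  set c : Ω → ℝ := fun ω => ∑ x ∈ S, if I ω x then 1 else 0 with hc
  have hR' : (0 : ℝ) < R := by exact_mod_cast hR
  have h1' : ∀ x ∈ S, (#{ω | I ω x} : ℝ) = N / R := by
    intro x hx
    rw [eq_div_iff hR'.ne']
    change (_ : ℝ) = ((Fintype.card Ω : ℕ) : ℝ)
    exact_mod_cast h1 x hx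
  have hN : 0 ≤ N := Nat.cast_nonneg _
  have hfirst : ∑ ω, c ω = s * (N / R) := by
    rw [hc, sum_comm]
    simp only [sum_boole]
    rw [sum_congr rfl h1', sum_const, nsmul_eq_mul]
  have hsecond : ∑ ω, c ω ^ 2 ≤ s * (N / R) + s ^ 2 * (N / R ^ 2) := by
    have e1 : ∀ ω, c ω ^ 2 = ∑ x ∈ S, ∑ y ∈ S, if I ω x ∧ I ω y then 1 else 0 := by
      intro ω
      rw [hc, sq, sum_mul_sum]
      refine sum_congr rfl fun x _ => sum_congr rfl fun y _ => ?_
      by_cases hx : I ω x <;> by_cases hy : I ω y <;> simp [hx, hy]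
    rw [sum_congr rfl fun ω _ => e1 ω, sum_comm]
    have e2 : ∀ x ∈ S, ∑ ω, ∑ y ∈ S, (if I ω x ∧ I ω y then (1 : ℝ) else 0) ≤
        N / R + s * (N / R ^ 2) := by
      intro x hx
      rw [sum_comm]
      simp only [sum_boole]
      rw [← add_sum_erase _ _ hx]
      refine add_le_add (by simp [h1' x hx]) ?_
      calc _ ≤ #(S.erase x) • (N / R ^ 2) := by
            refine sum_le_card_nsmul _ _ _ fun y hy => ?_
            rw [le_div_iff₀ (by positivity)]
            change (_ : ℝ) ≤ ((Fintype.card Ω : ℕ) : ℝ)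
            exact_mod_cast h2 x hx y (mem_of_mem_erase hy) (ne_of_mem_erase hy).symm
        _ ≤ _ := by
            rw [nsmul_eq_mul]
            refine mul_le_mul_of_nonneg_right ?_ (by positivity)
            exact Nat.cast_le.2 (card_le_card (erase_subset _ _))
    refine (sum_le_card_nsmul _ _ _ e2).trans_eq ?_
    rw [nsmul_eq_mul, ← hs]
    ring
  have hvar : ∑ ω, (c ω - s / R) ^ 2 ≤ s * (N / R) := by
    have e : ∀ ω, (c ω - s / R) ^ 2 = c ω ^ 2 - 2 * (s / R) * c ω + (s / R) ^ 2 := fun ω => by ring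
    rw [sum_congr rfl fun ω _ => e ω, sum_add_distrib, sum_sub_distrib, ← mul_sum, hfirst,
      sum_const, card_univ, nsmul_eq_mul]
    have e' : 2 * (s / R) * (s * (N / R)) = 2 * (s ^ 2 * (N / R ^ 2)) := by
      field_simp
    have e'' : N * (s / R) ^ 2 = s ^ 2 * (N / R ^ 2) := by
      field_simp
    change _ - _ + N * (s / R) ^ 2 ≤ _
    linarith
  -- Chebyshev: where everything is missed the count is 0, so it deviates from its mean `s / R` by
  -- the full mean.
  have hmiss : (#{ω | ∀ x ∈ S, ¬ I ω x} : ℝ) * (s / R) ^ 2 ≤ s * (N / R) := by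
    refine le_trans ?_ hvar
    rw [← nsmul_eq_mul]
    refine (card_nsmul_le_sum _ (fun ω => (c ω - s / R) ^ 2) _ fun ω hω => ?_).trans
      (sum_le_univ_sum_of_nonneg fun ω => by positivity)
    have : c ω = 0 := sum_eq_zero fun x hx => by simp [(mem_filter.1 hω).2 x hx]
    rw [this]
    exact le_of_eq (by ring)
  rcases S.eq_empty_or_nonempty with rfl | hS
  · simp
  have hs0 : 0 < s := Nat.cast_pos.2 hS.card_pos
  have : (#{ω | ∀ x ∈ S, ¬ I ω x} : ℝ) * s ≤ N * R := by
    have e1 : (#{ω | ∀ x ∈ S, ¬ I ω x} : ℝ) * (s / R) ^ 2 =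
        (#{ω | ∀ x ∈ S, ¬ I ω x} : ℝ) * s * (s / R ^ 2) := by ring
    have e2 : s * (N / R) = N * R * (s / R ^ 2) := by field_simp
    rw [e1, e2] at hmiss
    exact le_of_mul_le_mul_right hmiss (by positivity)
  change _ * ((#S : ℕ) : ℝ) ≤ ((Fintype.card Ω : ℕ) : ℝ) * R at this
  exact_mod_cast this

theorem card_fiber_mul_card {G H : Type} [AddGroup G] [AddGroup H] [Fintype G] [Fintype H]
    [DecidableEq H] (φ : G →+ H) (hφ : Function.Surjective φ) (h : H) :
    #{x | φ x = h} * Fintype.card H = Fintype.card G := by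
  have h1 : #(univ : Finset G) = ∑ k : H, #{x | φ x = k} :=
    card_eq_sum_card_fiberwise (fun _ _ => mem_coe.2 (mem_univ _))
  rw [card_univ, sum_congr rfl fun k _ => AddMonoidHom.card_fiber_eq_of_mem_range φ (hφ k) (hφ h),
    sum_const, card_univ, smul_eq_mul, mul_comm] at h1
  exact h1.symm

open Matrix

variable {ρ κ : Type} [Fintype κ] [DecidableEq κ]

/-- The evaluation of a matrix at a vector, as an additive map. -/
def mulVecHom (e : κ → ZMod 2) : Matrix ρ κ (ZMod 2) →+ (ρ → ZMod 2) where
  toFun N := N *ᵥ e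
  map_zero' := zero_mulVec e
  map_add' M N := add_mulVec M N e

theorem exists_dotProduct_eq_one {e : κ → ZMod 2} (he : e ≠ 0) : ∃ d : κ → ZMod 2, d ⬝ᵥ e = 1 := by
  obtain ⟨i, hi⟩ := Function.ne_iff.1 he
  refine ⟨Pi.single i 1, ?_⟩
  rw [single_one_dotProduct]
  have : ∀ a : ZMod 2, a ≠ 0 → a = 1 := by decide
  exact this _ hi

/-- Distinct non-zero vectors over the field with two elements are separated by a functional. -/
theorem exists_dotProduct_eq_one_zero {e e' : κ → ZMod 2} (he : e ≠ 0) (hne : e ≠ e') :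
    ∃ d : κ → ZMod 2, d ⬝ᵥ e = 1 ∧ d ⬝ᵥ e' = 0 := by
  have h01 : ∀ a : ZMod 2, a = 0 ∨ a = 1 := by decide
  by_cases he' : e' = 0
  · obtain ⟨d, hd⟩ := exists_dotProduct_eq_one he
    exact ⟨d, hd, by rw [he', dotProduct_zero]⟩
  obtain ⟨d, hd⟩ := exists_dotProduct_eq_one he
  obtain ⟨d', hd'⟩ := exists_dotProduct_eq_one (sub_ne_zero.2 hne)
  rw [dotProduct_sub] at hd'
  rcases h01 (d ⬝ᵥ e') with h | h
  · exact ⟨d, hd, h⟩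
  rcases h01 (d' ⬝ᵥ e') with k | k
  · exact ⟨d', by simpa [k] using hd', k⟩
  · refine ⟨d + d', ?_, ?_⟩
    · rw [add_dotProduct, hd, sub_eq_iff_eq_add.1 hd', k]
      decide
    · rw [add_dotProduct, h, k]
      decide

theorem mulVecHom_surjective {e : κ → ZMod 2} (he : e ≠ 0) :
    Function.Surjective (mulVecHom (ρ := ρ) e) := by
  intro w
  obtain ⟨d, hd⟩ := exists_dotProduct_eq_one he
  refine ⟨vecMulVec w d, ?_⟩
  change vecMulVec w d *ᵥ e = w
  rw [vecMulVec_mulVec, hd]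
  simp

/-- Distinct non-zero vectors over the field with two elements are linearly independent, so their
images under a uniform matrix are jointly uniform. -/
theorem mulVecHom_prod_surjective {e e' : κ → ZMod 2} (he : e ≠ 0) (he' : e' ≠ 0) (hne : e ≠ e') :
    Function.Surjective ((mulVecHom (ρ := ρ) e).prod (mulVecHom e')) := by
  rintro ⟨w, w'⟩
  obtain ⟨d, hd1, hd0⟩ := exists_dotProduct_eq_one_zero he hne
  obtain ⟨d', hd1', hd0'⟩ := exists_dotProduct_eq_one_zero he' hne.symm
  refine ⟨vecMulVec w d + vecMulVec w' d', ?_⟩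
  change ((vecMulVec w d + vecMulVec w' d') *ᵥ e, (vecMulVec w d + vecMulVec w' d') *ᵥ e') = (w, w')
  simp only [add_mulVec, vecMulVec_mulVec, hd1, hd0, hd1', hd0']
  simp

/-- The graph of a random matrix meets every large set of pairs with non-zero first component. -/
theorem card_matrix_missed_le [Fintype ρ] [DecidableEq ρ] {X : Type} (S : Finset X) (e : X → κ → ZMod 2) (d : X → ρ → ZMod 2)
    (he : ∀ x ∈ S, e x ≠ 0) (hinj : ∀ x ∈ S, ∀ y ∈ S, e x = e y → d x = d y → x = y)
    (T : Finset (Matrix ρ κ (ZMod 2))) (hT : ∀ N ∈ T, ∀ x ∈ S, N *ᵥ e x ≠ d x) :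
    #T * #S ≤ Fintype.card (Matrix ρ κ (ZMod 2)) * 2 ^ Fintype.card ρ := by
  have hcard : Fintype.card (ρ → ZMod 2) = 2 ^ Fintype.card ρ := by simp
  refine (Nat.mul_le_mul_right _ (card_le_card fun N hN => ?_)).trans
    (card_missed_mul_card_le S (fun (N : Matrix ρ κ (ZMod 2)) x => N *ᵥ e x = d x)
      (by positivity) ?_ ?_)
  · simpa using hT N hN
  · intro x hx
    rw [← hcard]
    exact card_fiber_mul_card (mulVecHom (e x)) (mulVecHom_surjective (he x hx)) (d x)
  · intro x hx y hy hxy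
    -- With equal first components the second ones differ, so the two events exclude each other.
    by_cases hexy : e x = e y
    · have : ({N | N *ᵥ e x = d x ∧ N *ᵥ e y = d y} : Finset (Matrix ρ κ (ZMod 2))) = ∅ := by
        refine filter_eq_empty_iff.2 fun N _ h => hxy (hinj x hx y hy hexy ?_)
        rw [← h.1, ← h.2, hexy]
      simp [this]
    · rw [← hcard, sq, ← Fintype.card_prod]
      refine le_of_eq ?_
      rw [← card_fiber_mul_card ((mulVecHom (ρ := ρ) (e x)).prod (mulVecHom (e y)))
        (mulVecHom_prod_surjective (he x hx) (he y hy) hexy) (d x, d y)]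
      congr 2
      ext N
      simp [mulVecHom]

/-- A string of bits, cut in two pieces, as a vector over the field with two elements. -/
def bitVector {a b : ℕ} (x : Fin (a + b) → Bool) : Fin a ⊕ Fin b → ZMod 2 :=
  fun i => ((x (finSumFinEquiv i)).toNat : ZMod 2)

theorem bitVector_injective {a b : ℕ} :
    Function.Injective (bitVector : (Fin (a + b) → Bool) → Fin a ⊕ Fin b → ZMod 2) := by
  intro x y h
  funext j
  obtain ⟨i, rfl⟩ := finSumFinEquiv.surjective j
  have h1 := congrFun h i
  have h2 : ∀ c d : Bool, (c.toNat : ZMod 2) = d.toNat → c = d := by decide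
  exact h2 _ _ h1

theorem innerProductGadget_eq {a b : ℕ} {x y : Fin (a + b) → Bool} {c : Bool}
    (h : bitVector x ⬝ᵥ bitVector y = (c.toNat : ZMod 2)) :
    innerProductGadget (a + b) x y = some c := by
  have h1 : ((∑ i, (x i).toNat * (y i).toNat : ℕ) : ZMod 2) = (c.toNat : ZMod 2) := by
    rw [← h, ← finSumFinEquiv.sum_comp]
    push_cast
    rfl
  rw [ZMod.natCast_eq_natCast_iff'] at h1
  unfold innerProductGadget
  rw [h1]
  cases c <;> rfl

theorem four_mul_le_of_mul_le {u w s N : ℕ} (hw : 0 < w) (h : u * s ≤ N * w) (h' : 4 * w ≤ s) :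
    4 * u ≤ N := by
  refine Nat.le_of_mul_le_mul_right (le_trans ?_ h) hw
  calc 4 * u * w = u * (4 * w) := by ring
    _ ≤ u * s := Nat.mul_le_mul_left u h'

/-- Write `x = (x', x'')` and `y = (y', y'')`. If `x'' = Nᵀ(x', 1)` and `N y'' = (y', c)`, then
`⟨x'', y''⟩ = ⟨x', y'⟩ + c`, hence `⟨x, y⟩ = c` in characteristic 2. The appended 1 carries `c` and
makes `(x', 1)` non-zero. -/
theorem hasHitting_innerProductGadget_add {a b : ℕ} {τ : ℝ}
    (hτ : ∀ s : ℕ, τ * 2 ^ (a + b) ≤ s → 4 * 2 ^ b ≤ s ∧ 9 * 2 ^ a ≤ s) :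
    HasHitting (innerProductGadget (a + b)) τ := by
  intro c
  set first : (Fin (a + b) → Bool) → Fin a ⊕ Unit → ZMod 2 :=
    fun x => Sum.elim (fun i => bitVector x (Sum.inl i)) 1 with hfirst
  set last : (Fin (a + b) → Bool) → Fin a ⊕ Unit → ZMod 2 :=
    fun y => Sum.elim (fun i => bitVector y (Sum.inl i)) (fun _ => (c.toNat : ZMod 2)) with hlast
  set right : (Fin (a + b) → Bool) → Fin b → ZMod 2 := fun x i => bitVector x (Sum.inr i)
    with hright
  have hinl : ∀ x y, (∀ i, bitVector x (Sum.inl i) = bitVector y (Sum.inl i)) →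
      right x = right y → x = y := by
    intro x y h h'
    refine bitVector_injective (funext fun i => ?_)
    rcases i with i | i
    · exact h i
    · exact congrFun h' i
  have hcube : Fintype.card (Fin (a + b) → Bool) = 2 ^ (a + b) := by simp
  refine ⟨Matrix (Fin a ⊕ Unit) (Fin b) (ZMod 2), inferInstance, inferInstance,
    fun N => {x | Nᵀ *ᵥ first x = right x}, fun N => {y | N *ᵥ right y = last y}, ?_, ?_, ?_⟩
  · intro N x hx y hy
    simp only [mem_filter, mem_univ, true_and] at hx hy
    refine innerProductGadget_eq ?_
    have h1 : bitVector x ⬝ᵥ bitVector y =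
        (∑ i, bitVector x (Sum.inl i) * bitVector y (Sum.inl i)) + right x ⬝ᵥ right y :=
      Fintype.sum_sum_type _
    have h2 : right x ⬝ᵥ right y =
        (∑ i, bitVector x (Sum.inl i) * bitVector y (Sum.inl i)) + (c.toNat : ZMod 2) := by
      rw [← hx, mulVec_transpose, ← dotProduct_mulVec, hy]
      simp [dotProduct, hfirst, hlast, Fintype.sum_sum_type]
    rw [h1, h2, ← add_assoc, CharTwo.add_self_eq_zero, zero_add]
  · intro S hS
    rw [hcube] at hS
    have hS' := (hτ #S (by exact_mod_cast hS)).1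
    have hmiss := card_matrix_missed_le S first right
      (fun x _ h => by simpa [hfirst] using congrFun h (Sum.inr ()))
      (fun x _ y _ h h' => hinl x y (fun i => congrFun h (Sum.inl i)) h')
      (({N | Disjoint S ({x | Nᵀ *ᵥ first x = right x} : Finset (Fin (a + b) → Bool))} :
        Finset (Matrix (Fin a ⊕ Unit) (Fin b) (ZMod 2))).image Matrix.transpose) (by
        intro N' hN' x hx h
        obtain ⟨N, hN, rfl⟩ := mem_image.1 hN'
        exact disjoint_left.1 (mem_filter.1 hN).2 hx (mem_filter.2 ⟨mem_univ _, h⟩))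
    have h2 : Fintype.card (Matrix (Fin b) (Fin a ⊕ Unit) (ZMod 2)) =
        Fintype.card (Matrix (Fin a ⊕ Unit) (Fin b) (ZMod 2)) :=
      Fintype.card_congr (Matrix.transposeAddEquiv _ _ _).toEquiv
    rw [h2, Fintype.card_fin, card_image_of_injective _ Matrix.transpose_injective] at hmiss
    exact four_mul_le_of_mul_le (by positivity) hmiss hS'
  · intro S hS
    rw [hcube] at hS
    have hS' := (hτ #S (by exact_mod_cast hS)).2
    -- On `y'' = 0` the product with `N` is not random. At most `2^a` such `y` are discarded, which
    -- turns the needed `8 * 2^a` into the `9 * 2^a` of `hτ`.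
    set S' : Finset (Fin (a + b) → Bool) := {y ∈ S | right y ≠ 0} with hS'def
    have hmiss := card_matrix_missed_le S' right last
      (fun y hy => (mem_filter.1 hy).2)
      (fun x _ y _ h h' => hinl x y (fun i => congrFun h' (Sum.inl i)) h)
      {N | Disjoint S ({y | N *ᵥ right y = last y} : Finset (Fin (a + b) → Bool))} (by
        intro N hN y hy h
        exact disjoint_left.1 (mem_filter.1 hN).2 (mem_filter.1 hy).1
          (mem_filter.2 ⟨mem_univ _, h⟩))
    have hcard : #S ≤ #S' + 2 ^ a := by
      rw [← card_filter_add_card_filter_not (s := S) (fun y => right y ≠ 0)]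
      refine Nat.add_le_add_left ?_ _
      have : #(univ : Finset (Fin a → ZMod 2)) = 2 ^ a := by simp
      rw [← this]
      refine card_le_card_of_injOn (fun y i => bitVector y (Sum.inl i)) (by simp) ?_
      intro x hx y hy h
      simp only [coe_filter, Set.mem_ofPred_eq, not_not] at hx hy
      exact hinl x y (congrFun h) (hx.2.trans hy.2.symm)
    have h3 : 4 * (2 ^ a * 2) ≤ #S' := by omega
    rw [Fintype.card_sum, Fintype.card_fin, Fintype.card_unit, pow_succ] at hmiss
    exact four_mul_le_of_mul_le (by positivity) hmiss h3

/-- An even split makes both size requirements of order `2^(n/2)`, far below `(2000/1007)^n`. -/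
theorem hasHitting_innerProductGadget {n : ℕ} (hn : 1000 ≤ n) :
    HasHitting (innerProductGadget n) ((1000 / 1007) ^ n) := by
  obtain ⟨a, b, rfl, hab, hba⟩ : ∃ a b, n = a + b ∧ a ≤ b ∧ b ≤ a + 1 :=
    ⟨n / 2, n - n / 2, by omega, by omega, by omega⟩
  refine hasHitting_innerProductGadget_add fun s hs => ?_
  have hsmall : (18 * 2 ^ a : ℝ) ≤ s := by
    refine le_trans ?_ hs
    have h1 : (18 : ℝ) ≤ (1 + 1 / 50) ^ (a + b) := by
      have h2 := one_add_mul_le_pow (a := (1 / 50 : ℝ)) (by norm_num) (a + b)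
      have h3 : (1000 : ℝ) ≤ (a + b : ℕ) := by exact_mod_cast hn
      linarith
    have h4 : (2 : ℝ) ^ a ≤ (3 / 2) ^ (a + b) := by
      calc (2 : ℝ) ^ a ≤ ((3 / 2) ^ 2) ^ a := pow_le_pow_left₀ (by norm_num) (by norm_num) a
        _ = (3 / 2) ^ (2 * a) := (pow_mul _ _ _).symm
        _ ≤ _ := pow_le_pow_right₀ (by norm_num) (by omega)
    calc (18 * 2 ^ a : ℝ) ≤ (1 + 1 / 50) ^ (a + b) * (3 / 2) ^ (a + b) := by gcongr
      _ = ((1 + 1 / 50) * (3 / 2)) ^ (a + b) := (mul_pow _ _ _).symm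
      _ ≤ (1000 / 1007 * 2) ^ (a + b) := pow_le_pow_left₀ (by norm_num) (by norm_num) _
      _ = _ := mul_pow _ _ _
  have hsmall' : 18 * 2 ^ a ≤ s := by exact_mod_cast hsmall
  have hb : 2 ^ b ≤ 2 * 2 ^ a := by
    rw [mul_comm, ← pow_succ]
    exact Nat.pow_le_pow_right (by norm_num) hba
  omega

end InnerProduct

/-! ### The upper bound -/

section UpperBound

/-- Alice can send an `n`-bit string at the cost of `n`. -/
theorem Protocol.exists_send {A B : Type} {Z : Type*} (n H : ℕ) (s : A → Fin n → Bool)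
    (π : (Fin n → Bool) → Protocol A B Z) (hπ : ∀ w, (π w).height ≤ H) :
    ∃ ρ : Protocol A B Z, ρ.height ≤ H + n ∧ ∀ a b, ρ.eval a b = (π (s a)).eval a b := by
  induction n with
  | zero => exact ⟨π Fin.elim0, hπ _, fun a b => by rw [Subsingleton.elim (s a) Fin.elim0]⟩
  | succ n ih =>
    have key : ∀ c : Bool, ∃ ρ : Protocol A B Z, ρ.height ≤ H + n ∧
        ∀ a b, ρ.eval a b = (π (Fin.cons c (Fin.tail (s a)))).eval a b := fun c =>
      ih (fun a => Fin.tail (s a)) (fun w => π (Fin.cons c w)) fun w => hπ _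
    choose ρ hρ hρ' using key
    refine ⟨.alice (fun a => s a 0) (ρ false) (ρ true), ?_, fun a b => ?_⟩
    · have h0 := hρ false
      have h1 := hρ true
      simp only [height]
      omega
    · have h := hρ' (s a 0) a b
      rw [Fin.cons_self_tail] at h
      rw [← h]
      cases hs : s a 0 <;> simp [eval, hs]

/-- The protocol that simulates a decision tree. -/
theorem DecisionTree.exists_protocol {n p : ℕ} {Y : Type} {Z : Type*} (T : DecisionTree p Z)
    (g : (Fin n → Bool) → Y → Option Bool) :
    ∃ π : Protocol (Fin p → Fin n → Bool) (Fin p → Y) Z, π.height ≤ T.height * (n + 1) ∧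
      ∀ x y, π.eval x y = T.eval fun i => (g (x i) (y i)).getD false := by
  induction T with
  | leaf w => exact ⟨.leaf w, by simp [Protocol.height], fun _ _ => rfl⟩
  | query i T0 T1 ih0 ih1 =>
    obtain ⟨π0, h0, e0⟩ := ih0
    obtain ⟨π1, h1, e1⟩ := ih1
    obtain ⟨π, hπ, e⟩ := Protocol.exists_send n (max π0.height π1.height + 1) (fun x => x i)
      -- The default `false` is harmless: correctness is required only where every gadget value is
      -- defined.
      (fun w => Protocol.bob (fun y => (g w (y i)).getD false) π0 π1) fun w => le_rfl
    refine ⟨π, hπ.trans ?_, fun x y => ?_⟩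
    · have h2 : max π0.height π1.height ≤ max T0.height T1.height * (n + 1) :=
        max_le (h0.trans (Nat.mul_le_mul_right _ (le_max_left _ _)))
          (h1.trans (Nat.mul_le_mul_right _ (le_max_right _ _)))
      rw [height, add_mul, one_mul]
      omega
    · rw [e x y, Protocol.eval, DecisionTree.eval, e0, e1]

theorem Dcc_composeGadget_le {n p : ℕ} {Y : Type} {Z : Type*} (f : (Fin p → Bool) → Z)
    (g : (Fin n → Bool) → Y → Option Bool) :
    Dcc (composeGadget f g) ≤ Ddt f * (n + 1) := by
  obtain ⟨T₀, hT₀⟩ := DecisionTree.exists_computes f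
  obtain ⟨T, hT, hheight⟩ := Nat.sInf_mem
    (s := {k | ∃ T : DecisionTree p Z, T.Computes f ∧ T.height = k}) ⟨_, T₀, hT₀, rfl⟩
  obtain ⟨π, hπ, e⟩ := T.exists_protocol g
  have hcomp : π.Computes (composeGadget f g) := by
    intro x y z hz
    unfold composeGadget at hz
    split_ifs at hz with h
    rw [e, hT, ← Option.some.inj hz]
    exact congrArg f (funext fun i => (Option.get_eq_getD _ (h := h i)).symm)
  have hDcc : Dcc (composeGadget f g) ≤ π.height := Nat.sInf_le ⟨π, hcomp, rfl⟩
  exact hDcc.trans (hπ.trans_eq (by rw [hheight]; rfl))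

end UpperBound

/-! ### Bounds for small `n` -/

section TrivialBounds

theorem exists_computes_height_le {p : ℕ} {Z : Type*} (f : (Fin p → Bool) → Z) :
    ∃ T : DecisionTree p Z, T.Computes f ∧ T.height ≤ p := by
  induction p with
  | zero => exact ⟨.leaf (f Fin.elim0), fun z => congrArg f (Subsingleton.elim _ _), le_rfl⟩
  | succ p ih =>
    choose T hT hheight using fun b => ih fun z => f (Fin.insertNth 0 b z)
    obtain ⟨S, hS, b, hb⟩ := DecisionTree.exists_query f 0 T hT
    exact ⟨S, hS, by rw [hb]; exact Nat.succ_le_succ (hheight b)⟩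

theorem Ddt_le {p : ℕ} {Z : Type*} (f : (Fin p → Bool) → Z) : Ddt f ≤ p := by
  obtain ⟨T, hT, h⟩ := exists_computes_height_le f
  have hle : Ddt f ≤ T.height := Nat.sInf_le ⟨T, hT, rfl⟩
  exact hle.trans h

/-- A protocol of height 0 is a constant, and a gadget that attains both values realises every `z`,
so `f` is constant. No lower bound on `n` enters. -/
theorem Ddt_eq_zero_of_Dcc_eq_zero {p : ℕ} {X Y : Type} [Finite X] [Finite Y] {Z : Type*}
    (f : (Fin p → Bool) → Z) {g : X → Y → Option Bool} (hg : ∀ c, ∃ x y, g x y = some c)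
    (h : Dcc (composeGadget f g) = 0) : Ddt f = 0 := by
  have : Nonempty Z := ⟨f fun _ => false⟩
  obtain ⟨π₀, hπ₀⟩ := Protocol.exists_computes (composeGadget f g)
  obtain ⟨π, hπ, hheight⟩ := Nat.sInf_mem (s := {k | ∃ π : Protocol (Fin p → X) (Fin p → Y) Z,
    π.Computes (composeGadget f g) ∧ π.height = k}) ⟨_, π₀, hπ₀, rfl⟩
  replace hheight : π.height = 0 := hheight.trans h
  cases π with
  | leaf w =>
    choose x y hxy using hg
    refine Nat.eq_zero_of_le_zero (Nat.sInf_le ⟨.leaf w, fun z => ?_, rfl⟩)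
    exact hπ (fun i => x (z i)) (fun i => y (z i)) (f z) (by simp [composeGadget, hxy])
  | alice m c0 c1 => simp [Protocol.height] at hheight
  | bob m c0 c1 => simp [Protocol.height] at hheight

theorem exists_innerProductGadget_eq {n : ℕ} (hn : 1 ≤ n) (c : Bool) :
    ∃ x y, innerProductGadget n x y = some c := by
  cases c
  · exact ⟨fun _ => false, fun _ => false, by simp [innerProductGadget]⟩
  · refine ⟨Pi.single ⟨0, hn⟩ true, fun _ => true, ?_⟩
    simp only [innerProductGadget, Bool.toNat_true, mul_one]
    rw [sum_eq_single ⟨0, hn⟩]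
    · simp
    · intro i _ hi
      rw [Pi.single_eq_of_ne hi]
      rfl
    · simp

theorem IsGapHamming.exists_eq {n : ℕ} (hn : 1 ≤ n) {γ : ℝ} (hγ0 : 0 ≤ γ) (hγ : γ ≤ 1 / 4)
    {g : (Fin n → Bool) → (Fin n → Bool) → Option Bool} (hg : IsGapHamming n γ g) (c : Bool) :
    ∃ x y, g x y = some c := by
  have hn' : (1 : ℝ) ≤ n := by exact_mod_cast hn
  cases c
  · refine ⟨fun _ => false, fun _ => false, ?_⟩
    obtain ⟨hs, ht, -⟩ := hg (fun _ => false) fun _ => false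
    rw [hammingDist_self, Nat.cast_zero] at hs ht
    obtain ⟨b, hb⟩ := Option.isSome_iff_exists.1 (hs.2 (Or.inr (by nlinarith)))
    cases b
    · exact hb
    · have := ht hb
      nlinarith
  · refine ⟨fun _ => false, fun _ => true, ?_⟩
    obtain ⟨hs, -, hf⟩ := hg (fun _ => false) fun _ => true
    have hd : hammingDist (fun _ : Fin n => false) (fun _ => true) = n := by simp [hammingDist]
    rw [hd] at hs hf
    obtain ⟨b, hb⟩ := Option.isSome_iff_exists.1 (hs.2 (Or.inl (by nlinarith)))
    cases b
    · have := hf hb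
      nlinarith
    · exact hb

end TrivialBounds

/-! ### Choice of parameters -/

section Parameters

theorem le_pow_of_le_two_rpow {n p : ℕ} (hp : (p : ℝ) ≤ (2 : ℝ) ^ ((n : ℝ) / 200)) :
    (p : ℝ) ≤ (100348 / 100000) ^ n := by
  refine hp.trans ?_
  rw [div_eq_inv_mul, Real.rpow_mul (by norm_num), Real.rpow_natCast]
  refine pow_le_pow_left₀ (by positivity) ?_ n
  refine le_of_pow_le_pow_left₀ (n := 200) (by norm_num) (by norm_num) ?_
  rw [← Real.rpow_natCast, ← Real.rpow_mul (by norm_num)]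
  norm_num

/-- Each factor is compared with an `n`-th power: `2^(1/800) < 1.0009`, `2^(1/200) < 1.00348`, and
`16 ≤ 1.0025^n` by Bernoulli, which is where `6000` comes from. The product of the bases with
`1000/1007` is below 1. -/
theorem two_pow_div_mul_le {n p : ℕ} (hn : 6000 ≤ n)
    (hp : (p : ℝ) ≤ (2 : ℝ) ^ ((n : ℝ) / 200)) :
    2 ^ (n / 800) * (16 * p * (1000 / 1007 : ℝ) ^ n) ≤ 1 := by
  have h1 : (2 : ℝ) ^ (n / 800) ≤ (10009 / 10000) ^ n := by
    calc (2 : ℝ) ^ (n / 800) ≤ (((10009 / 10000) ^ 80) ^ 10) ^ (n / 800) := by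
          refine pow_le_pow_left₀ (by norm_num) ?_ _
          -- The intermediate bound `1.0719 ≤ 1.0009^80` keeps the numbers to be checked small.
          refine le_trans ?_ (pow_le_pow_left₀ (a := (10719 / 10000 : ℝ)) (by norm_num) ?_ 10)
          · norm_num
          · norm_num
      _ = (10009 / 10000) ^ (800 * (n / 800)) := by
        rw [← pow_mul, ← pow_mul, ← mul_assoc]
        norm_num only
      _ ≤ _ := pow_le_pow_right₀ (by norm_num) (Nat.mul_div_le n 800)
  have h2 : (16 : ℝ) ≤ (1 + 1 / 400) ^ n := by
    have h := one_add_mul_le_pow (a := (1 / 400 : ℝ)) (by norm_num) n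
    have h' : (6000 : ℝ) ≤ n := by exact_mod_cast hn
    linarith
  have h3 := le_pow_of_le_two_rpow hp
  calc 2 ^ (n / 800) * (16 * p * (1000 / 1007 : ℝ) ^ n)
      ≤ (10009 / 10000) ^ n * ((1 + 1 / 400) ^ n * (100348 / 100000) ^ n * (1000 / 1007) ^ n) := by
        gcongr
    _ = (10009 / 10000 * ((1 + 1 / 400) * (100348 / 100000) * (1000 / 1007))) ^ n := by
        simp only [mul_pow]
    _ ≤ 1 := pow_le_one₀ (by norm_num) (by norm_num)

end Parameters

theorem theorem1 :
    ∃ c C : ℝ, 0 < c ∧ 0 < C ∧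
      ∀ (n p : ℕ), 1 ≤ n → (p : ℝ) ≤ (2 : ℝ) ^ ((n : ℝ) / 200) →
      ∀ (Z : Type*) (f : (Fin p → Bool) → Z)
        (g : (Fin n → Bool) → (Fin n → Bool) → Option Bool),
        (g = innerProductGadget n ∨ ∃ γ : ℝ, 0 ≤ γ ∧ γ ≤ 1 / 4 ∧ IsGapHamming n γ g) →
        c * ((Ddt f : ℝ) * (n : ℝ)) ≤ (Dcc (composeGadget f g) : ℝ) ∧
          (Dcc (composeGadget f g) : ℝ) ≤ C * ((Ddt f : ℝ) * (n : ℝ)) := by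
  -- For `n < 6000` one has `p ≤ 2^30`, so `Ddt f * n ≤ 6000 * 2^30`; for larger `n` the simulation
  -- gives the better constant `1/3200`. The `2` absorbs `n + 1 ≤ 2n`.
  refine ⟨1 / (6000 * 2 ^ 30), 2, by positivity, by norm_num, ?_⟩
  intro n p hn hp Z f g hg
  have hn' : (1 : ℝ) ≤ n := by exact_mod_cast hn
  constructor
  · rcases lt_or_ge n 6000 with hsmall | hlarge
    · have hsmall' : (n : ℝ) ≤ 6000 := by exact_mod_cast hsmall.le
      rcases Nat.eq_zero_or_pos (Dcc (composeGadget f g)) with h0 | h0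
      · have hvals : ∀ c, ∃ x y, g x y = some c := by
          rcases hg with rfl | ⟨γ, hγ0, hγ, hg⟩
          · exact exists_innerProductGadget_eq hn
          · exact hg.exists_eq hn hγ0 hγ
        rw [Ddt_eq_zero_of_Dcc_eq_zero f hvals h0]
        simp
      · have h1 : (1 : ℝ) ≤ Dcc (composeGadget f g) := by exact_mod_cast h0
        have h2 : (Ddt f : ℝ) ≤ 2 ^ 30 := by
          calc (Ddt f : ℝ) ≤ p := by exact_mod_cast Ddt_le f
            _ ≤ (2 : ℝ) ^ ((n : ℝ) / 200) := hp
            _ ≤ (2 : ℝ) ^ (30 : ℝ) :=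
              Real.rpow_le_rpow_of_exponent_le (by norm_num) (by linarith)
            _ = 2 ^ 30 := by exact_mod_cast Real.rpow_natCast 2 30
        calc 1 / (6000 * 2 ^ 30) * ((Ddt f : ℝ) * (n : ℝ))
            ≤ 1 / (6000 * 2 ^ 30) * (2 ^ 30 * 6000) := by gcongr
          _ = 1 := by norm_num
          _ ≤ _ := h1
    · have hhit : HasHitting g ((1000 / 1007) ^ n) := by
        rcases hg with rfl | ⟨γ, hγ0, hγ, hg⟩
        · exact hasHitting_innerProductGadget (by omega)
        · exact hg.hasHitting (by omega) hγ0 hγ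
      have h1 := hhit.mul_Ddt_le (by positivity) (pow_le_one₀ (by norm_num) (by norm_num))
        (two_pow_div_mul_le hlarge hp) f
      -- Rounding down in `n / 800` costs at most a factor 2 here.
      have h2 : n ≤ 1600 * (n / 800) := by omega
      have h3 : Ddt f * n ≤ 3200 * Dcc (composeGadget f g) := by
        calc Ddt f * n ≤ Ddt f * (1600 * (n / 800)) := by gcongr
          _ = 1600 * (n / 800 * Ddt f) := by ring
          _ ≤ 1600 * (2 * Dcc (composeGadget f g)) := by gcongr
          _ = _ := by ring
      have h4 : (Ddt f : ℝ) * n ≤ 3200 * Dcc (composeGadget f g) := by exact_mod_cast h3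
      have h5 : (0 : ℝ) ≤ (Ddt f : ℝ) * n := by positivity
      linarith
  · have h1 : (Dcc (composeGadget f g) : ℝ) ≤ Ddt f * (n + 1) := by
      exact_mod_cast Dcc_composeGadget_le f g
    have h2 : (0 : ℝ) ≤ Ddt f := Nat.cast_nonneg _
    nlinarith
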